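/- **Setting.** A *tile* in $\mathbb{R}^d$ is a (nonempty) compact connected set that is the closure of its interior; a *patch* is a collection of tiles with pairwise disjoint interiors, its *support* is the union of its tiles, and a *tiling* is a patch with support $\mathbb{R}^d$. Two patches are *equivalent* if one is a translate of the other. For tilings $x,y$ let $d_T(x,y)$ be the infimum of $\{\sqrt2/2\}$ together with all $0<r<\sqrt2/2$ for which there are patches $x'\subseteq x$, $y'\subseteq y$ with bounded supports containing the closed ball $B_{1/r}=\{\vec v:\|\vec v\|\le 1/r\}$, and $\vec t\in\mathbb{R}^d$ with $\|\vec t\|\le r$, $\vec t+x'=y'$. Let $X$ be a translation-invariant set of tilings of $\mathbb{R}^d$ that is complete for $d_T$ and has finite local complexity, i.e. up to translation there are only finitely many two-tile patches with connected support contained in tilings of $X$. Let $\mathcal P^1(X)$ be the set of tiles, and $\mathcal P(X)$ the set of finite patches, contained in tilings of $X$. Suppose that $\mathcal P^1(X)$ has finitely many tiles up to translation, and let $D_1,\dots,D_l$ be representatives of the classes, without repetition. A *substitution* is a map $S:\mathcal P^1(X)\to\mathcal P(X)$ for which there is $\lambda>1$ with $\mathrm{supp}\,S(D)=\lambda D$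 and $S(\vec t+D)=\lambda\vec t+S(D)$ for all $D\in\mathcal P^1(X)$, $\vec t\in\mathbb{R}^d$, and which extends to a map $S:X\to X$, where $S(x)=\bigcup_{D\in x}S(D)$; the same formula defines $S$ on patches. Its *structure matrix* $A$ has as entry $A_{ij}$ the number of tiles equivalent to $D_i$ in $S(D_j)$. $S$ is *strongly recognizable* if $S:X\to X$ is injective and, for all $x\in X$ and $D\in\mathcal P^1(X)$, $S(D)\subseteq S(x)$ implies $D\in x$. Let $\mathcal S=\{S_j\}_{j\in J}$ be a finite family of substitutions with dilatation factors $\lambda_j$ and structure matrices $A_j$, which is *primitive*: for every sequence $\bar b\in J^{\mathbb N}$ and every $n\geq 1$ there is $N\ge 0$ such that $A_{b_n}A_{b_{n+1}}\cdots A_{b_{n+N}}$ has only positive entries. For $\bar a=(a_1,a_2,\dots)\in J^{\mathbb N}$ put $\sigma(\bar a)=(a_2,a_3,\dots)$ and $S^k_{\bar a}=S_{a_1}\circ\cdots\circ S_{a_k}$. Fix $D\in\mathcal P^1(X)$, put $x^1_{\bar a}=\{D\}$ and $x^k_{\bar a}=S^k_{\bar a}(D)$ for $k>1$, and let $X_{\bar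 a}$ be the set of all $x\in X$ such that each finite patch of $x$ has a translate contained in $x^k_{\bar a}$ for some $k>0$. Give $X_{\bar a}$ the topology of $d_T$, its Borel $\sigma$-algebra, and the action $T$ of $\mathbb{R}^d$ by translations. **Theorem.** If every $S_j$, $j\in J$, is strongly recognizable, then for every $\bar a\in J^{\mathbb N}$ the systems $(X_{\bar a},T)$ and $(X_{\sigma(\bar a)},T)$ are uniquely ergodic; let $\mu_{\bar a}$ and $\mu_{\sigma(\bar a)}$ be their unique translation-invariant Borel probability measures, which are ergodic. The map $x\mapsto S_{a_1}(x)$ is a homeomorphism from $X_{\sigma(\bar a)}$ onto $X_{\bar a}$, it carries $\mu_{\sigma(\bar a)}$ to $\mu_{\bar a}$, and $$S_{a_1}(\vec t+x)=\lambda_{a_1}\vec t+S_{a_1}(x)\qquad(\vec t\in\mathbb{R}^d,\ x\in X_{\sigma(\bar a)}).$$ Thus, with the group isomorphism $\xi(\vec t)=\lambda_{a_1}\vec t$ of $\mathbb{R}^d$, it is an isomorphism of the ergodic dynamical systems $(X_{\sigma(\bar a)},T,\mu_{\sigma(\bar a)})$ and $(X_{\bar a},T,\mu_{\bar a})$. 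-/

import Mathlib

open MeasureTheory Set
open scoped Pointwise

namespace MultiTiling

/-- Euclidean space of dimension `d`. -/
abbrev Euc (d : ℕ) : Type := EuclideanSpace ℝ (Fin d)

variable {d : ℕ}

/-- A tile: a compact connected (in particular nonempty) set, equal to the closure of its
interior. -/
def IsTile (D : Set (Euc d)) : Prop :=
  IsCompact D ∧ IsConnected D ∧ closure (interior D) = D

/-- A patch: a collection of tiles with pairwise disjoint interiors. -/
def IsPatch (p : Set (Set (Euc d))) : Prop :=
  (∀ D ∈ p, IsTile D) ∧ p.Pairwise fun D D' => Disjoint (interior D) (interior D')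

/-- A tiling: a patch whose support is the whole space. -/
def IsTiling (p : Set (Set (Euc d))) : Prop :=
  IsPatch p ∧ ⋃₀ p = univ

variable (d) in
/-- The type of all tilings of `ℝ^d`. -/
@[ext]
structure Tiling where
  tiles : Set (Set (Euc d))
  isTiling : IsTiling tiles

theorem IsTile.vadd {D : Set (Euc d)} (h : IsTile D) (t : Euc d) : IsTile (t +ᵥ D) := by
  refine ⟨h.1.vadd t, ?_, ?_⟩
  · exact h.2.1.image _ (continuous_const_vadd t).continuousOn
  · rw [interior_vadd, closure_vadd, h.2.2]

theorem IsTiling.vadd {p : Set (Set (Euc d))} (h : IsTiling p) (t : Euc d) :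
    IsTiling (t +ᵥ p) := by
  refine ⟨⟨?_, ?_⟩, ?_⟩
  · rintro _ ⟨D, hD, rfl⟩
    exact (h.1.1 D hD).vadd t
  · rintro _ ⟨D, hD, rfl⟩ _ ⟨D', hD', rfl⟩ hne
    have hne' : D ≠ D' := fun e => hne (by rw [e])
    have := h.1.2 hD hD' hne'
    change Disjoint (interior (t +ᵥ D)) (interior (t +ᵥ D'))
    rw [interior_vadd, interior_vadd]
    exact Set.disjoint_image_iff (AddAction.injective t) |>.2 this
  · refine eq_univ_of_forall fun v => ?_
    have hv : -t +ᵥ v ∈ ⋃₀ p := h.2 ▸ mem_univ _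
    obtain ⟨D, hD, hvD⟩ := hv
    exact ⟨t +ᵥ D, ⟨D, hD, rfl⟩, Set.mem_vadd_set_iff_neg_vadd_mem.2 hvD⟩

/-- The action of `ℝ^d` on tilings by translations. -/
instance : AddAction (Euc d) (Tiling d) where
  vadd t x := ⟨t +ᵥ x.tiles, x.isTiling.vadd t⟩
  zero_vadd x := Tiling.ext (zero_vadd _ x.tiles)
  add_vadd s t x := Tiling.ext (add_vadd s t x.tiles)

/-- `x[[K]]`: the patches of `x` with bounded support covering `K`. -/
def coveringPatches (x : Tiling d) (K : Set (Euc d)) : Set (Set (Set (Euc d))) :=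
  {p | p ⊆ x.tiles ∧ Bornology.IsBounded (⋃₀ p) ∧ K ⊆ ⋃₀ p}

/-- The tiling distance `d_T`. -/
noncomputable def tilingDist (x y : Tiling d) : ℝ :=
  sInf ({√2 / 2} ∪ {r : ℝ | 0 < r ∧ r < √2 / 2 ∧
    ∃ p ∈ coveringPatches x (Metric.closedBall 0 (1 / r)),
    ∃ q ∈ coveringPatches y (Metric.closedBall 0 (1 / r)),
    ∃ t : Euc d, ‖t‖ ≤ r ∧ t +ᵥ p = q})

variable (d) in
/-- A translation-invariant set of tilings of `ℝ^d`. -/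
structure TilingSpace where
  carrier : Set (Tiling d)
  vadd_mem' : ∀ (t : Euc d) (x : Tiling d), x ∈ carrier → t +ᵥ x ∈ carrier

instance : SetLike (TilingSpace d) (Tiling d) where
  coe := TilingSpace.carrier
  coe_injective X Y h := by cases X; cases Y; congr

namespace TilingSpace

/-- The action `T` of `ℝ^d` on `X` by translations. -/
instance (X : TilingSpace d) : AddAction (Euc d) X where
  vadd t x := ⟨t +ᵥ x.1, X.vadd_mem' t x.1 x.2⟩
  zero_vadd x := Subtype.ext (zero_vadd _ x.1)
  add_vadd s t x := Subtype.ext (add_vadd s t x.1)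

/-- The topology of the distance `d_T` on `X`. -/
instance (X : TilingSpace d) : TopologicalSpace X where
  IsOpen U := ∀ x ∈ U, ∃ ε > 0, ∀ y : X, tilingDist x.1 y.1 < ε → y ∈ U
  isOpen_univ := fun _ _ => ⟨1, one_pos, fun _ _ => mem_univ _⟩
  isOpen_inter := by
    rintro U V hU hV x ⟨hxU, hxV⟩
    obtain ⟨ε, hε, h⟩ := hU x hxU
    obtain ⟨δ, hδ, h'⟩ := hV x hxV
    exact ⟨min ε δ, lt_min hε hδ, fun y hy =>
      ⟨h y (hy.trans_le (min_le_left _ _)), h' y (hy.trans_le (min_le_right _ _))⟩⟩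
  isOpen_sUnion := by
    rintro s hs x ⟨U, hU, hxU⟩
    obtain ⟨ε, hε, h⟩ := hs U hU x hxU
    exact ⟨ε, hε, fun y hy => ⟨U, hU, h y hy⟩⟩

/-- The Borel σ-algebra of `(X, d_T)`. -/
instance (X : TilingSpace d) : MeasurableSpace X := borel X

instance (X : TilingSpace d) : BorelSpace X := ⟨rfl⟩

/-- `(X, d_T)` is complete. -/
def IsComplete (X : TilingSpace d) : Prop :=
  ∀ u : ℕ → X,
    (∀ ε > 0, ∃ N, ∀ m ≥ N, ∀ n ≥ N, tilingDist (u m).1 (u n).1 < ε) →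
    ∃ x : X, ∀ ε > 0, ∃ N, ∀ n ≥ N, tilingDist (u n).1 x.1 < ε

/-- The tiles of the tilings in `X`, i.e. the patches of `X` consisting of one tile. -/
def tileSet (X : TilingSpace d) : Set (Set (Euc d)) :=
  {D | ∃ x ∈ X, D ∈ x.tiles}

/-- The patches of `X` consisting of `N` tiles. -/
def patchesOfCard (X : TilingSpace d) (N : ℕ) : Set (Set (Set (Euc d))) :=
  {p | p.encard = N ∧ ∃ x ∈ X, p ⊆ x.tiles}

/-- The finite patches of `X`. -/
def patches (X : TilingSpace d) : Set (Set (Set (Euc d))) :=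
  ⋃ N, X.patchesOfCard N

/-- The translation class of a patch. -/
def patchClass (p : Set (Set (Euc d))) : Set (Set (Set (Euc d))) :=
  {q | ∃ t : Euc d, q = t +ᵥ p}

/-- Finite local complexity: up to translation, there are finitely many patches of two tiles
with connected support. -/
def HasFLC (X : TilingSpace d) : Prop :=
  (patchClass '' {p ∈ X.patchesOfCard 2 | IsConnected (⋃₀ p)}).Finite

/-- `P 0, …, P (l - 1)` is a system of representatives, without repetition, of the tiles of `X` up
to translation. -/
structure IsPrototiles (X : TilingSpace d) {l : ℕ} (P : Fin l → Set (Euc d)) : Prop where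
  mem : ∀ i, P i ∈ X.tileSet
  inequiv : ∀ i j, (∃ t : Euc d, P j = t +ᵥ P i) → i = j
  exists_equiv : ∀ D ∈ X.tileSet, ∃ i, ∃ t : Euc d, D = t +ᵥ P i

/-- `μ` is the unique ergodic measure of `(X, T)`: it is an ergodic (in particular translation
invariant) Borel probability measure, and the only translation invariant Borel probability
measure. -/
structure IsUniqueErgodicMeasure (X : TilingSpace d) (μ : Measure X) : Prop where
  isProbabilityMeasure : IsProbabilityMeasure μ
  ergodic : ErgodicVAdd (Euc d) X μ
  unique : ∀ ν : Measure X, IsProbabilityMeasure ν → VAddInvariantMeasure (Euc d) X ν → ν = μ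

/-- `ξ` and `F` form an isomorphism from `(X, T, μ)` onto `(Y, T, ν)`: `F` is a measure
preserving homeomorphism intertwining the actions through the group isomorphism `ξ`. -/
structure IsSystemIso {X Y : TilingSpace d} (μ : Measure X) (ν : Measure Y)
    (ξ : Euc d ≃+ Euc d) (F : X ≃ₜ Y) : Prop where
  measurePreserving : MeasurePreserving F μ ν
  map_vadd : ∀ (t : Euc d) (x : X), F (t +ᵥ x) = ξ t +ᵥ F x

end TilingSpace

/-- The collection of all tiles of the patches `f D`, for `D` in `p`. -/
def substPatch (f : Set (Euc d) → Set (Set (Euc d))) (p : Set (Set (Euc d))) :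
    Set (Set (Euc d)) :=
  ⋃ D ∈ p, f D

/-- A self-similar substitution `S` from the tiles of `X` to the finite patches of `X` that extends
to a map `X → X`. Only the values of `toFun` on the tiles of `X` matter. -/
structure Substitution (X : TilingSpace d) where
  toFun : Set (Euc d) → Set (Set (Euc d))
  /-- The dilatation factor. -/
  dil : ℝ
  one_lt_dil : 1 < dil
  mem_patches : ∀ D ∈ X.tileSet, toFun D ∈ X.patches
  support_eq : ∀ D ∈ X.tileSet, ⋃₀ toFun D = dil • D
  map_vadd : ∀ D ∈ X.tileSet, ∀ t : Euc d, toFun (t +ᵥ D) = (dil • t) +ᵥ toFun D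
  extends_tilings : ∀ x ∈ X, ∃ h : IsTiling (substPatch toFun x.tiles),
    (⟨substPatch toFun x.tiles, h⟩ : Tiling d) ∈ X

namespace Substitution

variable {X : TilingSpace d}

/-- The extension of `S` to patches. -/
def onPatch (S : Substitution X) (p : Set (Set (Euc d))) : Set (Set (Euc d)) :=
  substPatch S.toFun p

/-- The extension of `S` to a map `X → X`. -/
def onTiling (S : Substitution X) (x : X) : X :=
  ⟨⟨S.onPatch x.1.tiles, (S.extends_tilings x.1 x.2).1⟩, (S.extends_tilings x.1 x.2).2⟩

/-- `S : X → X` is injective. -/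
def Recognizable (S : Substitution X) : Prop :=
  Function.Injective S.onTiling

/-- `S` is recognizable and `S(D) ⊆ S(x)` only if `D ∈ x`. -/
def StronglyRecognizable (S : Substitution X) : Prop :=
  S.Recognizable ∧
    ∀ x : X, ∀ D ∈ X.tileSet, S.toFun D ⊆ (S.onTiling x).1.tiles → D ∈ x.1.tiles

/-- The structure matrix: its entry at `(i, j)` is the number of tiles equivalent to `P i` in
`S (P j)`. -/
noncomputable def structureMatrix (S : Substitution X) {l : ℕ} (P : Fin l → Set (Euc d)) :
    Matrix (Fin l) (Fin l) ℕ :=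
  Matrix.of fun i j => {D ∈ S.toFun (P j) | ∃ t : Euc d, D = t +ᵥ P i}.ncard

end Substitution

variable {X : TilingSpace d} {J : Type*}

/-- The shift `σ (a₁, a₂, …) = (a₂, a₃, …)`; the entry `a₁` is `a 0`. -/
def shift (a : ℕ → J) : ℕ → J := fun n => a (n + 1)

/-- The product `A_{b_n} A_{b_{n+1}} ⋯ A_{b_{n+N}}` of structure matrices. -/
noncomputable def matrixProd (S : J → Substitution X) {l : ℕ} (P : Fin l → Set (Euc d))
    (b : ℕ → J) (n N : ℕ) : Matrix (Fin l) (Fin l) ℕ :=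
  ((List.range (N + 1)).map fun i => (S (b (n + i))).structureMatrix P).prod

/-- The family of substitutions is primitive: for every sequence `b` and every `n` some product
`A_{b_n} ⋯ A_{b_{n+N}}` has only positive entries. -/
def PrimitiveSet (S : J → Substitution X) {l : ℕ} (P : Fin l → Set (Euc d)) : Prop :=
  ∀ (b : ℕ → J) (n : ℕ), ∃ N, ∀ i j, 0 < matrixProd S P b n N i j

/-- `S_a^k = S_{a₁} ∘ ⋯ ∘ S_{a_k}` on patches. -/
def compPatch (S : J → Substitution X) : (ℕ → J) → ℕ → Set (Set (Euc d)) → Set (Set (Euc d))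
  | _, 0, p => p
  | a, k + 1, p => (S (a 0)).onPatch (compPatch S (shift a) k p)

/-- The patches `x_a^1 = D` and `x_a^k = S_a^k(D)`, `k > 1`. -/
def levelPatch (S : J → Substitution X) (a : ℕ → J) (D : Set (Euc d)) (k : ℕ) :
    Set (Set (Euc d)) :=
  if k = 1 then {D} else compPatch S a k {D}

/-- The multi-substitution tiling space `X_a` (with initial tile `D`): the tilings `x` in `X` such
that every finite patch of `x` has a translate contained in some `x_a^k`, `k > 0`. -/
def multiSpace (S : J → Substitution X) (a : ℕ → J) (D : Set (Euc d)) : TilingSpace d where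
  carrier := {x | x ∈ X ∧ ∀ p ⊆ x.tiles, p.Finite →
    ∃ k > 0, ∃ t : Euc d, t +ᵥ p ⊆ levelPatch S a D k}
  vadd_mem' := by
    rintro s x ⟨hx, h⟩
    refine ⟨X.vadd_mem' s x hx, fun p hp hfin => ?_⟩
    have hp' : -s +ᵥ p ⊆ x.tiles := by
      rintro _ ⟨D', hD', rfl⟩
      obtain ⟨D'', hD'', rfl⟩ := hp hD'
      simpa using hD''
    obtain ⟨k, hk, t, ht⟩ := h _ hp' (hfin.image _)
    refine ⟨k, hk, t + -s, ?_⟩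
    rwa [add_vadd]

end MultiTiling

namespace MultiTiling

variable {d : ℕ}

/-! ### Tiles and tilings -/

/-! The proof has three ingredients: compactness, desubstitution, and contraction of averages over
supertiles.

Compactness. The sets of pairs of tilings that agree on a ball of radius `1/ε` up to a shift of norm
at most `ε` form a uniform structure inducing the topology of `d_T` (`topology_eq`), so the triangle
inequality for `d_T` is never needed. Finite local complexity leaves finitely many patches around a
tile in standard position, which gives total boundedness. With completeness, `X` is compact, and so
is `X_a`, being closed in `X`.

Desubstitution. Since `S_a^{n+k}(D)` is `S_a^n` applied to an iterate of `D` along the shifted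
sequence, large patches of a tiling in `X_a` lie inside images under `S_a^n`. A limit of the
preimages shows that `S_a^n` maps the space of the shifted sequence onto `X_a`
(`exists_onTiling_iter_eq`). For `n = 1` recognizability makes the map injective, and a continuous
bijection from a compact space to a Hausdorff space is a homeomorphism.

Unique ergodicity. Let `φ` be continuous on `X_a` and suppose that its averages over all level-`n`
supertiles lie in an interval of width `w`. Because tile boundaries are null
(`Substitution.volume_boundary`), the average over a supertile of high level depends on its type
only, up to a small error `e` (`exists_variation_le`). By primitivity and compactness of `J^ℕ` there
is one `K`, valid for all sequences, such that every level-`(n+K)` supertile contains level-`n`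
supertiles of every type, each filling at least a fraction `δ` of it. Hence `K` levels higher the
width is at most `(1-δ)w + 2δe` (`SupertileBound.contract`), and iteration makes it arbitrarily
small. A large ball is filled by supertiles up to a negligible boundary layer, so ball averages
converge uniformly to a constant (`exists_ballAvg_bound`). The Riesz representation of this limit is
the only invariant probability measure, and uniqueness forces ergodicity (`exists_unique_ergodic`).
Finally the substitution pushes the invariant measure forward to an invariant measure, which
uniqueness identifies (`IsUniqueErgodicMeasure.isSystemIso`). -/

theorem IsTile.isClosed {D : Set (Euc d)} (h : IsTile D) : IsClosed D := h.1.isClosed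

theorem IsTile.nonempty {D : Set (Euc d)} (h : IsTile D) : D.Nonempty := h.2.1.nonempty

theorem IsTile.nonempty_interior {D : Set (Euc d)} (h : IsTile D) : (interior D).Nonempty := by
  rw [← closure_nonempty_iff, h.2.2]
  exact h.nonempty

theorem IsTile.inter_interior_nonempty {D U : Set (Euc d)} (h : IsTile D) (hU : IsOpen U)
    (hDU : (D ∩ U).Nonempty) : (interior D ∩ U).Nonempty := by
  by_contra hne
  have h1 : Disjoint U (interior D) := by
    rw [disjoint_iff_inter_eq_empty, inter_comm]
    exact not_nonempty_iff_eq_empty.1 hne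
  have h2 := h1.closure_right hU
  rw [h.2.2] at h2
  obtain ⟨v, hv, hv'⟩ := hDU
  exact disjoint_left.1 h2 hv' hv

theorem Tiling.isTile (x : Tiling d) {D : Set (Euc d)} (hD : D ∈ x.tiles) : IsTile D :=
  x.isTiling.1.1 D hD

/-- A tile is the closure of its interior, so if it meets the interior of another tile then the two
interiors overlap. This is the basic device for identifying tiles throughout. -/
theorem Tiling.eq_of_inter (x : Tiling d) {D E : Set (Euc d)} (hD : D ∈ x.tiles)
    (hE : E ∈ x.tiles) {v : Euc d} (hv : v ∈ D) (hv' : v ∈ interior E) : D = E := by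
  by_contra hne
  obtain ⟨w, hw, hw'⟩ := (x.isTile hD).inter_interior_nonempty isOpen_interior ⟨v, hv, hv'⟩
  exact disjoint_left.1 (x.isTiling.1.2 hD hE hne) hw hw'

theorem Tiling.exists_mem (x : Tiling d) (v : Euc d) : ∃ D ∈ x.tiles, v ∈ D := by
  have := x.isTiling.2 ▸ mem_univ v
  exact this

theorem Tiling.mem_vadd {x : Tiling d} {t : Euc d} {D : Set (Euc d)} :
    D ∈ (t +ᵥ x).tiles ↔ -t +ᵥ D ∈ x.tiles :=
  Set.mem_vadd_set_iff_neg_vadd_mem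

theorem Tiling.vadd_mem_vadd {x : Tiling d} {t : Euc d} {D : Set (Euc d)} :
    t +ᵥ D ∈ (t +ᵥ x).tiles ↔ D ∈ x.tiles := by
  rw [Tiling.mem_vadd, neg_vadd_vadd]

theorem Tiling.mem_of_subset (x : Tiling d) {q : Set (Set (Euc d))} (hq : q ⊆ x.tiles)
    {E U : Set (Euc d)} (hE : E ∈ x.tiles) (hU : IsOpen U) (hUq : U ⊆ ⋃₀ q)
    (hEU : (E ∩ U).Nonempty) : E ∈ q := by
  obtain ⟨v, hv, hvU⟩ := (x.isTile hE).inter_interior_nonempty hU hEU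
  obtain ⟨D, hD, hvD⟩ := hUq hvU
  rwa [← x.eq_of_inter (hq hD) hE hvD hv]

theorem Tiling.eq_of_subset {x y : Tiling d} (h : x.tiles ⊆ y.tiles) : x = y := by
  refine Tiling.ext (h.antisymm fun E hE => ?_)
  refine y.mem_of_subset h hE isOpen_univ x.isTiling.2.ge ?_
  simpa using (y.isTile hE).nonempty

/-! ### Agreement of tilings on balls -/

/-- The translate by `t` of the part of `x` near the ball of radius `R` belongs to `y`. -/
def Agree (R : ℝ) (t : Euc d) (x y : Tiling d) : Prop :=
  ∀ D ∈ x.tiles, (D ∩ Metric.ball 0 R).Nonempty → t +ᵥ D ∈ y.tiles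

theorem Agree.mono {R R' : ℝ} {t : Euc d} {x y : Tiling d} (h : Agree R t x y) (hR : R' ≤ R) :
    Agree R' t x y := fun D hD hDR =>
  h D hD (hDR.mono (inter_subset_inter_right _ (Metric.ball_subset_ball hR)))

/-- Near an interior point `v` of a tile of `y`, the tile of `x` through `v - t` reappears in `y`
after the shift and must be that tile. The point `v - t` has to stay in the ball, which costs `‖t‖`
in the radius. -/
theorem Agree.symm {R : ℝ} {t : Euc d} {x y : Tiling d} (h : Agree R t x y) :
    Agree (R - ‖t‖) (-t) y x := by
  intro E hE hER
  obtain ⟨v, hvE, hv⟩ := (y.isTile hE).inter_interior_nonempty Metric.isOpen_ball hER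
  obtain ⟨D, hD, hvD⟩ := x.exists_mem (-t + v)
  have hvb : -t + v ∈ Metric.ball (0 : Euc d) R := by
    rw [mem_ball_zero_iff] at hv ⊢
    have := norm_add_le (-t) v
    rw [norm_neg] at this
    linarith
  have h1 := h D hD ⟨_, hvD, hvb⟩
  have h2 : v ∈ t +ᵥ D := by
    rw [Set.mem_vadd_set_iff_neg_vadd_mem]; exact hvD
  rw [← y.eq_of_inter h1 hE h2 hvE, neg_vadd_vadd]
  exact hD

theorem Agree.trans {R R' : ℝ} {s t : Euc d} {x y z : Tiling d} (h : Agree R t x y)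
    (h' : Agree R' s y z) (hR : R + ‖t‖ ≤ R') : Agree R (s + t) x z := by
  intro D hD hDR
  rw [add_vadd]
  refine h' _ (h D hD hDR) ?_
  obtain ⟨v, hvD, hv⟩ := hDR
  refine ⟨t + v, Set.vadd_mem_vadd_set hvD, ?_⟩
  rw [mem_ball_zero_iff] at hv ⊢
  have := norm_add_le t v
  linarith

theorem agree_vadd (R : ℝ) (t : Euc d) (x : Tiling d) : Agree R t x (t +ᵥ x) :=
  fun _ hD _ => Tiling.vadd_mem_vadd.2 hD

theorem Agree.vadd {R : ℝ} {s : Euc d} {x y : Tiling d} (h : Agree R s x y) (t : Euc d) :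
    Agree (R - ‖t‖) s (t +ᵥ x) (t +ᵥ y) := by
  have := ((agree_vadd (R - ‖t‖) (-t) (t +ᵥ x)).trans (s := s) (R' := R) (z := y)
    (by rwa [neg_vadd_vadd]) (by simp)).trans (agree_vadd (R + ‖s + -t‖) t y) (by simp)
  simpa [add_comm] using this

theorem exists_agree_of_tilingDist_lt {x y : Tiling d} {r : ℝ} (hr : r ≤ √2 / 2)
    (h : tilingDist x y < r) : ∃ t : Euc d, ‖t‖ ≤ r ∧ Agree (1 / r) t x y := by
  obtain ⟨s, hs, hsr⟩ := exists_lt_of_csInf_lt ⟨√2 / 2, Or.inl rfl⟩ h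
  rcases hs with hs | ⟨hs0, -, p, hp, q, hq, t, ht, hpq⟩
  · rw [mem_singleton_iff] at hs; linarith
  · refine ⟨t, by linarith, fun D hD hDR => hq.1 ?_⟩
    rw [← hpq]
    refine Set.vadd_mem_vadd_set ?_
    refine x.mem_of_subset hp.1 hD Metric.isOpen_ball ?_ hDR
    refine (Metric.ball_subset_closedBall).trans ((Metric.closedBall_subset_closedBall ?_).trans hp.2.2)
    exact one_div_le_one_div_of_le hs0 hsr.le

theorem tilingDist_le_of_agree {x y : Tiling d} {C r R : ℝ} {t : Euc d}
    (hC : ∀ D ∈ x.tiles, Metric.diam D ≤ C) (hr0 : 0 < r) (hr : r < √2 / 2) (ht : ‖t‖ ≤ r)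
    (hR : 1 / r + r < R) (h : Agree R t x y) : tilingDist x y ≤ r := by
  have hr1 : 0 < 1 / r := by positivity
  have hcov : ∀ v ∈ Metric.ball (0 : Euc d) R,
      v ∈ ⋃₀ {D ∈ x.tiles | (D ∩ Metric.ball 0 R).Nonempty} := fun v hv => by
    obtain ⟨D, hD, hvD⟩ := x.exists_mem v
    exact ⟨D, ⟨hD, v, hvD, hv⟩, hvD⟩
  have hbdd : Bornology.IsBounded (⋃₀ {D ∈ x.tiles | (D ∩ Metric.ball 0 R).Nonempty}) := by
    refine (Metric.isBounded_ball (x := (0 : Euc d)) (r := R + C + 1)).subset ?_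
    rintro w ⟨D, ⟨hD, v, hvD, hv⟩, hw⟩
    have h1 := Metric.dist_le_diam_of_mem (x.isTile hD).1.isBounded hw hvD
    have h2 := hC D hD
    rw [Metric.mem_ball] at hv ⊢
    have := dist_triangle w v 0
    linarith
  -- The witness is the patch of all tiles meeting the ball of radius `R`. The margin `1 / r + r <
  -- R` lets its translate still cover the ball of radius `1 / r`; the diameter bound serves only to
  -- keep the support bounded.
  refine csInf_le ⟨0, ?_⟩ (Or.inr ⟨hr0, hr, {D ∈ x.tiles | (D ∩ Metric.ball 0 R).Nonempty},
    ⟨fun D hD => hD.1, hbdd, fun v hv => hcov v ?_⟩,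
    t +ᵥ {D ∈ x.tiles | (D ∩ Metric.ball 0 R).Nonempty}, ⟨?_, ?_, ?_⟩, t, ht, rfl⟩)
  · rintro s (hs | hs)
    · rw [mem_singleton_iff] at hs; rw [hs]; positivity
    · exact hs.1.le
  · rw [mem_closedBall_zero_iff] at hv
    rw [mem_ball_zero_iff]; linarith
  · rintro _ ⟨D, hD, rfl⟩
    exact h D hD.1 hD.2
  · have := hbdd.vadd t
    refine this.subset ?_
    rintro w ⟨_, ⟨D, hD, rfl⟩, hw⟩
    obtain ⟨w', hw', rfl⟩ := hw
    exact ⟨w', ⟨D, hD, hw'⟩, rfl⟩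
  · intro v hv
    rw [mem_closedBall_zero_iff] at hv
    obtain ⟨D, hD, hvD⟩ := hcov (-t + v) (by
      rw [mem_ball_zero_iff]
      have := norm_add_le (-t) v
      rw [norm_neg] at this
      linarith)
    exact ⟨t +ᵥ D, ⟨D, hD, rfl⟩, by rw [Set.mem_vadd_set_iff_neg_vadd_mem]; exact hvD⟩

/-! ### The uniform structure -/

/-- The entourages of the uniform structure on tilings. -/
def tilingEntourage (d : ℕ) (ε : ℝ) : Set (Tiling d × Tiling d) :=
  {p | ∃ t : Euc d, ‖t‖ ≤ ε ∧ Agree (1 / ε) t p.1 p.2}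

theorem tilingEntourage_mono {ε ε' : ℝ} (h0 : 0 < ε) (h : ε ≤ ε') :
    tilingEntourage d ε ⊆ tilingEntourage d ε' := fun _ ⟨t, ht, h1⟩ =>
  ⟨t, ht.trans h, h1.mono (one_div_le_one_div_of_le h0 h)⟩

/-- One choice of `δ` serves for both symmetry and composition: two shifts of size `δ` add up to at
most `ε`, and a radius `1 / δ` survives the loss of one shift. -/
theorem exists_entourage_half {ε : ℝ} (h : 0 < ε) :
    ∃ δ > 0, 2 * δ ≤ ε ∧ 1 / ε + δ ≤ 1 / δ := by
  have hm : 0 < min ε 1 := by positivity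
  refine ⟨min ε 1 / 2, by positivity, by linarith [min_le_left ε 1], ?_⟩
  have h1 : 1 / ε ≤ 1 / min ε 1 := one_div_le_one_div_of_le hm (min_le_left _ _)
  have h2 : 1 ≤ 1 / min ε 1 := by
    rw [le_div_iff₀ hm]; linarith [min_le_right ε 1]
  have h3 : 1 / (min ε 1 / 2) = 2 * (1 / min ε 1) := by field_simp
  rw [h3]
  linarith [min_le_right ε 1]

/-- The sets `tilingEntourage d ε`, `ε > 0`, as a filter basis. -/
def tilingFilterBasis (d : ℕ) : FilterBasis (Tiling d × Tiling d) where
  sets := {s | ∃ ε > 0, tilingEntourage d ε = s}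
  nonempty := ⟨_, 1, one_pos, rfl⟩
  inter_sets := by
    rintro _ _ ⟨ε, hε, rfl⟩ ⟨δ, hδ, rfl⟩
    have := lt_min hε hδ
    exact ⟨_, ⟨min ε δ, this, rfl⟩, subset_inter (tilingEntourage_mono this (min_le_left _ _))
      (tilingEntourage_mono this (min_le_right _ _))⟩

/-- The uniform structure of the tiling distance. -/
@[reducible]
def tilingUniformSpace (d : ℕ) : UniformSpace (Tiling d) :=
  UniformSpace.ofCore <| UniformSpace.Core.mkOfBasis (tilingFilterBasis d)
    (by
      rintro _ ⟨ε, hε, rfl⟩ x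
      exact ⟨0, by simpa using hε.le, fun D hD _ => by simpa using hD⟩)
    (by
      rintro _ ⟨ε, hε, rfl⟩
      obtain ⟨δ, hδ, h1, h2⟩ := exists_entourage_half hε
      refine ⟨_, ⟨δ, hδ, rfl⟩, ?_⟩
      rintro ⟨x, y⟩ ⟨t, ht, h⟩
      exact ⟨-t, by rw [norm_neg]; linarith, h.symm.mono (by linarith)⟩)
    (by
      rintro _ ⟨ε, hε, rfl⟩
      obtain ⟨δ, hδ, h1, h2⟩ := exists_entourage_half hε
      refine ⟨_, ⟨δ, hδ, rfl⟩, ?_⟩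
      rintro ⟨x, z⟩ ⟨y, ⟨t, ht, h⟩, ⟨s, hs, h'⟩⟩
      refine ⟨s + t, by linarith [norm_add_le s t], ?_⟩
      exact Agree.trans (h.mono (by linarith)) h' (by linarith))

theorem hasBasis_tilingUniformSpace :
    (@uniformity _ (tilingUniformSpace d)).HasBasis (fun ε : ℝ => 0 < ε) (tilingEntourage d) := by
  constructor
  intro s
  change s ∈ (tilingFilterBasis d).filter ↔ _
  rw [FilterBasis.mem_filter_iff]
  constructor
  · rintro ⟨_, ⟨ε, hε, rfl⟩, h⟩
    exact ⟨ε, hε, h⟩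
  · rintro ⟨ε, hε, h⟩
    exact ⟨_, ⟨ε, hε, rfl⟩, h⟩

namespace TilingSpace

/-- The tiles of `X` have uniformly bounded diameters. -/
def HasBoundedTiles (X : TilingSpace d) : Prop := ∃ C, ∀ D ∈ X.tileSet, Metric.diam D ≤ C

theorem HasBoundedTiles.exists_radius {X : TilingSpace d} (hX : X.HasBoundedTiles) {ε : ℝ}
    (hε : 0 < ε) : ∃ δ > 0, ∀ x ∈ X, ∀ y : Tiling d, (x, y) ∈ tilingEntourage d δ →
      tilingDist x y < ε := by
  obtain ⟨C, hC⟩ := hX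
  set r := min (ε / 2) (1 / 2) with hr
  have hr0 : 0 < r := by positivity
  have hs : (1 : ℝ) < √2 := by
    rw [Real.lt_sqrt] <;> norm_num
  obtain ⟨δ, hδ, h1, h2⟩ := exists_entourage_half hr0
  obtain ⟨δ', hδ', h1', h2'⟩ := exists_entourage_half (ε := min δ (1/2)) (by positivity)
  have hr2 : r ≤ 1 / 2 := min_le_right _ _
  have hd2 : min δ (1/2) ≤ 1/2 := min_le_right _ _
  have h3 : 1 / δ ≤ 1 / (min δ (1/2)) := one_div_le_one_div_of_le (by positivity) (min_le_left _ _)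
  have h4 : 2 ≤ 1 / r := by rw [le_div_iff₀ hr0]; linarith
  refine ⟨min δ' (1 / (1 / r + r + 1)), by positivity, fun x hx y ⟨t, ht, h⟩ => ?_⟩
  refine (tilingDist_le_of_agree (t := t) (R := 1 / r + r + 1) (r := r)
    (fun D hD => hC D ⟨x, hx, hD⟩) hr0 ?_ ?_ (by linarith) (h.mono ?_)).trans_lt ?_
  · linarith
  · refine ht.trans ((min_le_left _ _).trans ?_)
    linarith [min_le_left δ (1/2)]
  · rw [le_div_iff₀ (by positivity)]
    have := min_le_right δ' (1 / (1 / r + r + 1))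
    rwa [le_div_iff₀ (by positivity), mul_comm] at this
  · linarith [min_le_left (ε / 2) (1 / 2)]

/-- Small entourages and small `d_T`-balls are interleaved. Bounded diameters are needed in only one
direction, to make the patches that witness a small distance bounded. -/
theorem HasBoundedTiles.topology_eq {X : TilingSpace d} (hX : X.HasBoundedTiles) :
    (inferInstance : TopologicalSpace X) =
      ((tilingUniformSpace d).comap ((↑) : X → Tiling d)).toTopologicalSpace := by
  refine TopologicalSpace.ext_iff.2 fun U => ?_
  let u := (tilingUniformSpace d).comap ((↑) : X → Tiling d)
  have hb : (uniformity X).HasBasis (fun ε : ℝ => 0 < ε) _ :=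
    hasBasis_tilingUniformSpace.comap (fun q : X × X => (q.1.1, q.2.1))
  have hopen : @IsOpen X u.toTopologicalSpace U ↔ ∀ x ∈ U, ∃ ε > 0, ∀ y : X,
      (x.1, y.1) ∈ tilingEntourage d ε → y ∈ U := by
    rw [@isOpen_iff_mem_nhds X u.toTopologicalSpace U]
    refine forall₂_congr fun x hx => ?_
    rw [(nhds_basis_uniformity' hb).mem_iff]
    rfl
  change (∀ x ∈ U, ∃ ε > 0, ∀ y : X, tilingDist x.1 y.1 < ε → y ∈ U) ↔ _
  rw [hopen]
  refine forall₂_congr fun x hx => ?_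
  constructor
  · rintro ⟨ε, hε, h⟩
    obtain ⟨δ, hδ, h'⟩ := hX.exists_radius hε
    exact ⟨δ, hδ, fun y hy => h y (h' _ x.2 _ hy)⟩
  · rintro ⟨ε, hε, h⟩
    -- Below the cap `√2 / 2` a bound on the distance is witnessed by actual patches.
    refine ⟨min ε (√2 / 2), by positivity, fun y hy => h y ?_⟩
    refine tilingEntourage_mono (by positivity) (min_le_left ε (√2 / 2)) ?_
    exact exists_agree_of_tilingDist_lt (min_le_right _ _) hy

/-- The uniform structure on `X`, inducing its topology. -/
@[reducible]
def HasBoundedTiles.uniformSpace {X : TilingSpace d} (hX : X.HasBoundedTiles) : UniformSpace X :=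
  ((tilingUniformSpace d).comap ((↑) : X → Tiling d)).replaceTopology hX.topology_eq

theorem HasBoundedTiles.hasBasis {X : TilingSpace d} (hX : X.HasBoundedTiles) :
    (@uniformity X hX.uniformSpace).HasBasis (fun ε : ℝ => 0 < ε)
      (fun ε => {q | (q.1.1, q.2.1) ∈ tilingEntourage d ε}) :=
  hasBasis_tilingUniformSpace.comap (fun q : X × X => (q.1.1, q.2.1))

theorem HasBoundedTiles.isCountablyGenerated {X : TilingSpace d} (hX : X.HasBoundedTiles) :
    (@uniformity X hX.uniformSpace).IsCountablyGenerated := by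
  let _ := hX.uniformSpace
  have : (uniformity X).HasBasis (fun _ : ℕ => True)
      (fun n => {q | (q.1.1, q.2.1) ∈ tilingEntourage d (1 / ((n : ℝ) + 1))}) := by
    refine hX.hasBasis.to_hasBasis (fun ε hε => ?_) (fun n _ => ⟨_, by positivity, subset_rfl⟩)
    obtain ⟨n, hn⟩ := exists_nat_one_div_lt hε
    exact ⟨n, trivial, fun q hq => tilingEntourage_mono (by positivity) hn.le hq⟩
  exact this.isCountablyGenerated

end TilingSpace

/-- Otherwise the set would be stable under all multiples of the nonzero vector `s - t`, contrary to
boundedness. -/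
theorem IsTile.vadd_injective {D : Set (Euc d)} (hD : IsTile D) {s t : Euc d}
    (h : s +ᵥ D = t +ᵥ D) : s = t := by
  by_contra hne
  have hk : ∀ n : ℕ, ∀ v ∈ D, (n : ℝ) • (s - t) + v ∈ D := by
    intro n
    induction n with
    | zero => intro v hv; simpa using hv
    | succ n ih =>
      intro v hv
      have h1 : s +ᵥ ((n : ℝ) • (s - t) + v) ∈ t +ᵥ D := by
        rw [← h]; exact Set.vadd_mem_vadd_set (ih v hv)
      rw [Set.mem_vadd_set_iff_neg_vadd_mem] at h1
      convert h1 using 1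
      simp only [vadd_eq_add]
      push_cast
      module
  obtain ⟨v, hv⟩ := hD.nonempty
  obtain ⟨n, hn⟩ := exists_nat_gt (Metric.diam D / ‖s - t‖)
  have h1 := Metric.dist_le_diam_of_mem hD.1.isBounded (hk n v hv) hv
  rw [dist_eq_norm, add_sub_cancel_right, norm_smul, Real.norm_natCast] at h1
  have h2 : 0 < ‖s - t‖ := norm_pos_iff.2 (sub_ne_zero.2 hne)
  rw [div_lt_iff₀ h2] at hn
  linarith

/-- Each tile `D` of `x` has arbitrarily small translates in `y`. Sufficiently small ones overlap,
hence coincide as tiles of `y`, hence are translates by the same vector, which must then be zero. -/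
theorem Tiling.eq_of_forall_agree {x y : Tiling d}
    (h : ∀ ε > 0, (x, y) ∈ tilingEntourage d ε) : x = y := by
  refine Tiling.eq_of_subset fun D hD => ?_
  obtain ⟨v, hv⟩ := (x.isTile hD).nonempty_interior
  obtain ⟨r, hr, hrD⟩ := Metric.isOpen_iff.1 isOpen_interior v hv
  -- all sufficiently small translations of `D` into `y` overlap, hence are equal
  have key : ∀ ε > 0, ε ≤ min (r / 4) (1 / (‖v‖ + 1)) →
      ∃ t : Euc d, ‖t‖ ≤ ε ∧ t +ᵥ D ∈ y.tiles := by
    intro ε hε hε'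
    obtain ⟨t, ht, ha⟩ := h ε hε
    refine ⟨t, ht, ha D hD ⟨v, interior_subset hv, ?_⟩⟩
    rw [mem_ball_zero_iff]
    have : ε ≤ 1 / (‖v‖ + 1) := hε'.trans (min_le_right _ _)
    rw [le_div_iff₀ (by positivity)] at this
    show ‖v‖ < 1 / ε
    rw [lt_div_iff₀ hε]
    nlinarith
  set ε₀ := min (r / 4) (1 / (‖v‖ + 1)) with hε₀
  have hε₀' : 0 < ε₀ := by positivity
  have hr4 : ε₀ ≤ r / 4 := min_le_left _ _
  obtain ⟨t, ht, hty⟩ := key ε₀ hε₀' le_rfl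
  have ht0 : t = 0 := by
    by_contra hne
    have htp : 0 < ‖t‖ := norm_pos_iff.2 hne
    -- A second translate by a vector at most half as long as `t` cannot be the translate by `t`.
    obtain ⟨s, hs, hsy⟩ := key (min ε₀ (‖t‖ / 2)) (by positivity) (min_le_left _ _)
    have hs1 : ‖s‖ ≤ ε₀ := hs.trans (min_le_left _ _)
    have hs2 : ‖s‖ ≤ ‖t‖ / 2 := hs.trans (min_le_right _ _)
    have heq : t +ᵥ D = s +ᵥ D := by
      refine y.eq_of_inter hty hsy (v := t + v) ?_ ?_
      · exact Set.vadd_mem_vadd_set (interior_subset hv)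
      · rw [interior_vadd, Set.mem_vadd_set_iff_neg_vadd_mem]
        refine hrD ?_
        rw [Metric.mem_ball, dist_eq_norm]
        have : (-s +ᵥ (t + v)) - v = t - s := by simp only [vadd_eq_add]; abel
        rw [this]
        linarith [norm_sub_le t s]
    have := (x.isTile hD).vadd_injective heq
    rw [this] at htp hs2
    linarith
  simpa [ht0] using hty

theorem TilingSpace.HasBoundedTiles.t2Space {X : TilingSpace d} (hX : X.HasBoundedTiles) :
    T2Space X := by
  let _ := hX.uniformSpace
  have : T0Space X := by
    rw [t0Space_iff_uniformity]
    intro x y h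
    refine Subtype.ext (Tiling.eq_of_forall_agree fun ε hε => ?_)
    exact h _ (hX.hasBasis.mem_of_mem hε)
  infer_instance

end MultiTiling

namespace MultiTiling

variable {d : ℕ}

/-! ### Local finiteness and compactness -/

theorem totallyBounded_univ_of_code {α β : Type*} [UniformSpace α]
    (h : ∀ V ∈ uniformity α, ∃ f : α → β, (range f).Finite ∧ ∀ x y, f x = f y → (x, y) ∈ V) :
    TotallyBounded (univ : Set α) := by
  intro V hV
  obtain ⟨f, hf, hfV⟩ := h V hV
  have : Finite (range f) := hf
  refine ⟨range (rangeSplitting f), finite_range _, fun x _ => ?_⟩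
  simp only [mem_iUnion]
  exact ⟨_, mem_range_self ⟨f x, mem_range_self x⟩, hfV _ _ (apply_rangeSplitting f ⟨f x, mem_range_self x⟩).symm⟩

namespace TilingSpace

variable {X : TilingSpace d} {l : ℕ} {P : Fin l → Set (Euc d)}

theorem vadd_mem {t : Euc d} {x : Tiling d} (hx : x ∈ X) : t +ᵥ x ∈ X := X.vadd_mem' t x hx

theorem isTile_of_mem {D : Set (Euc d)} (hD : D ∈ X.tileSet) : IsTile D := by
  obtain ⟨x, -, h⟩ := hD
  exact x.isTile h

theorem vadd_mem_tileSet {D : Set (Euc d)} (hD : D ∈ X.tileSet) (t : Euc d) :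
    t +ᵥ D ∈ X.tileSet := by
  obtain ⟨x, hx, h⟩ := hD
  exact ⟨t +ᵥ x, vadd_mem hx, Tiling.vadd_mem_vadd.2 h⟩

theorem IsPrototiles.exists_diam_le (hP : X.IsPrototiles P) :
    ∃ C > 0, ∀ D ∈ X.tileSet, Metric.diam D ≤ C := by
  refine ⟨1 + ∑ i, Metric.diam (P i), ?_, fun D hD => ?_⟩
  · have := Finset.sum_nonneg (s := Finset.univ) fun i _ => Metric.diam_nonneg (s := P i)
    linarith
  · obtain ⟨i, t, rfl⟩ := hP.exists_equiv D hD
    rw [show Metric.diam (t +ᵥ P i) = Metric.diam (P i) from (isometry_vadd (Euc d) t).diam_image _]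
    have := Finset.single_le_sum (f := fun i => Metric.diam (P i))
      (fun i _ => Metric.diam_nonneg) (Finset.mem_univ i)
    linarith

theorem IsPrototiles.hasBoundedTiles (hP : X.IsPrototiles P) : X.HasBoundedTiles := by
  obtain ⟨C, -, hC⟩ := hP.exists_diam_le
  exact ⟨C, hC⟩

theorem volume_vadd (D : Set (Euc d)) (t : Euc d) : volume (t +ᵥ D) = volume D :=
  measure_vadd volume t D

theorem IsPrototiles.exists_le_volume (hP : X.IsPrototiles P) :
    ∃ c > 0, ∀ D ∈ X.tileSet, c ≤ volume (interior D) := by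
  have hpos : ∀ i, 0 < volume (interior (P i)) := fun i =>
    isOpen_interior.measure_pos _ (isTile_of_mem (hP.mem i)).nonempty_interior
  rcases isEmpty_or_nonempty (Fin l) with h | h
  · refine ⟨1, one_pos, fun D hD => ?_⟩
    obtain ⟨i, -⟩ := hP.exists_equiv D hD
    exact h.elim i
  · obtain ⟨i₀, hi₀⟩ := Finite.exists_min fun i => volume (interior (P i))
    refine ⟨_, hpos i₀, fun D hD => ?_⟩
    obtain ⟨i, t, rfl⟩ := hP.exists_equiv D hD
    rw [interior_vadd, volume_vadd]
    exact hi₀ i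

/-- A packing argument: the interiors are disjoint, have volume bounded below, and all lie in the
ball of radius `R + C + 1`. -/
theorem IsPrototiles.exists_encard_le (hP : X.IsPrototiles P) (R : ℝ) :
    ∃ M : ℕ, ∀ x ∈ X, ∀ v : Euc d,
      {D ∈ x.tiles | (D ∩ Metric.ball v R).Nonempty}.encard ≤ M := by
  obtain ⟨C, hC0, hC⟩ := hP.exists_diam_le
  obtain ⟨c, hc, hcP⟩ := hP.exists_le_volume
  have hfin : volume (Metric.ball (0 : Euc d) (R + C + 1)) / c ≠ ⊤ :=
    ENNReal.div_ne_top measure_ball_lt_top.ne hc.ne'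
  obtain ⟨M, hM⟩ := ENNReal.exists_nat_gt hfin
  refine ⟨M, fun x hx v => ?_⟩
  by_contra! hlt
  obtain ⟨F, hF, hFc⟩ := exists_subset_encard_eq (Order.add_one_le_of_lt hlt)
  have hFfin : F.Finite := finite_of_encard_le_coe (k := M + 1) (by rw [hFc]; norm_cast)
  have hcard : hFfin.toFinset.card = M + 1 := by
    have := hFfin.encard_eq_coe_toFinset_card
    rw [hFc] at this
    exact_mod_cast this.symm
  have hvol : ∑ D ∈ hFfin.toFinset, volume (interior D) ≤ volume (Metric.ball v (R + C + 1)) := by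
    rw [← measure_biUnion_finset]
    · refine measure_mono (iUnion₂_subset fun D hD w hw => ?_)
      obtain ⟨hDx, u, huD, hu⟩ := hF (hFfin.mem_toFinset.1 hD)
      have h1 := Metric.dist_le_diam_of_mem (x.isTile hDx).1.isBounded (interior_subset hw) huD
      have h2 := hC D ⟨x, hx, hDx⟩
      rw [Metric.mem_ball] at hu ⊢
      linarith [dist_triangle w u v]
    · intro D hD E hE hne
      exact x.isTiling.1.2 (hF (hFfin.mem_toFinset.1 hD)).1 (hF (hFfin.mem_toFinset.1 hE)).1 hne
    · exact fun D _ => isOpen_interior.measurableSet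
  have hsum : (M + 1 : ℕ) * c ≤ ∑ D ∈ hFfin.toFinset, volume (interior D) := by
    rw [← hcard, ← nsmul_eq_mul]
    exact Finset.card_nsmul_le_sum _ _ _ fun D hD =>
      hcP D ⟨x, hx, (hF (hFfin.mem_toFinset.1 hD)).1⟩
  have h3 := hsum.trans hvol
  rw [Measure.addHaar_ball_center] at h3
  have h4 : ((M + 1 : ℕ) : ENNReal) ≤ volume (Metric.ball (0 : Euc d) (R + C + 1)) / c := by
    rw [ENNReal.le_div_iff_mul_le (Or.inl hc.ne') (Or.inr measure_ball_lt_top.ne)]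
    exact h3
  have h5 := h4.trans_lt hM
  norm_cast at h5
  omega

theorem IsPrototiles.finite_inter_ball (hP : X.IsPrototiles P) {x : Tiling d} (hx : x ∈ X)
    (v : Euc d) (R : ℝ) : {D ∈ x.tiles | (D ∩ Metric.ball v R).Nonempty}.Finite := by
  obtain ⟨M, hM⟩ := hP.exists_encard_le R
  exact finite_of_encard_le_coe (hM x hx v)

variable (X) in
/-- The tile `D` and its neighbours in tilings of `X`. -/
def neighbors (D : Set (Euc d)) : Set (Set (Euc d)) :=
  {E | ∃ x ∈ X, D ∈ x.tiles ∧ E ∈ x.tiles ∧ (D ∩ E).Nonempty}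

/-- There are finitely many translation classes of pairs `{D, E}`, and each comes from at most two
neighbours: a translation carrying one such pair to another either fixes `D` and is zero, or carries
`E` to `D`, which determines it. -/
theorem HasFLC.finite_neighbors (h : X.HasFLC) {D : Set (Euc d)} (hD : D ∈ X.tileSet) :
    (X.neighbors D).Finite := by
  have hDt := isTile_of_mem hD
  suffices hs : (X.neighbors D \ {D}).Finite from
    (hs.union (finite_singleton D)).subset fun E hE => by
      by_cases hED : E = D
      · exact Or.inr hED
      · exact Or.inl ⟨hE, hED⟩
  -- a neighbour is determined by the class of the pair
  refine Finite.of_finite_fibers (fun E => patchClass {D, E}) (h.subset ?_) ?_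
  · rintro _ ⟨E, ⟨⟨x, hx, hDx, hEx, hDE⟩, hne⟩, rfl⟩
    refine ⟨{D, E}, ⟨⟨encard_pair (Ne.symm hne), x, hx, ?_⟩, ?_⟩, rfl⟩
    · rintro _ (rfl | rfl) <;> assumption
    · rw [sUnion_pair]
      exact IsConnected.union hDE hDt.2.1 (x.isTile hEx).2.1
  · rintro _ ⟨E, ⟨⟨x, hx, hDx, hEx, hDE⟩, hne⟩, rfl⟩
    have hEt := x.isTile hEx
    have hsub : (X.neighbors D \ {D}) ∩ (fun E => patchClass {D, E}) ⁻¹' {patchClass {D, E}} ⊆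
        {E} ∪ {E' | ∃ t : Euc d, t +ᵥ E = D ∧ E' = t +ᵥ D} := by
      rintro E' ⟨⟨-, hne'⟩, heq⟩
      have h1 : ({D, E'} : Set (Set (Euc d))) ∈ patchClass {D, E} := by
        rw [← show patchClass {D, E'} = patchClass {D, E} from heq]
        exact ⟨0, (zero_vadd _ _).symm⟩
      obtain ⟨t, ht⟩ := h1
      have ht' : ({D, E'} : Set (Set (Euc d))) = {t +ᵥ D, t +ᵥ E} := by
        rw [ht]; exact image_pair _ _ _
      rcases Set.pair_eq_pair_iff.1 ht' with ⟨h2, h3⟩ | ⟨h2, h3⟩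
      · have : (0 : Euc d) = t := hDt.vadd_injective (by rwa [zero_vadd])
        left
        rw [h3, ← this, zero_vadd]; rfl
      · exact Or.inr ⟨t, h2.symm, h3⟩
    refine ((finite_singleton E).union (Set.Subsingleton.finite ?_)).subset hsub
    rintro _ ⟨t, ht, rfl⟩ _ ⟨s, hs, rfl⟩
    rw [hEt.vadd_injective (ht.trans hs.symm)]

variable (X) in
/-- The tiles reachable from `D` by chains of `k` neighbours in tilings of `X`. -/
def chain (D : Set (Euc d)) : ℕ → Set (Set (Euc d))
  | 0 => {D}
  | k + 1 => ⋃ E ∈ chain D k, X.neighbors E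

theorem chain_subset_tileSet {D : Set (Euc d)} (hD : D ∈ X.tileSet) (k : ℕ) :
    X.chain D k ⊆ X.tileSet := by
  cases k with
  | zero => rintro _ rfl; exact hD
  | succ k =>
    refine iUnion₂_subset fun E _ => ?_
    rintro F ⟨x, hx, -, hF, -⟩
    exact ⟨x, hx, hF⟩

theorem HasFLC.finite_chain (h : X.HasFLC) {D : Set (Euc d)} (hD : D ∈ X.tileSet) (k : ℕ) :
    (X.chain D k).Finite := by
  induction k with
  | zero => exact finite_singleton D
  | succ k ih =>
    exact ih.biUnion fun E hE => h.finite_neighbors (chain_subset_tileSet hD k hE)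

/-- If a chain stopped growing before reaching every tile that meets the ball, the tiles reached and
those missed would split the connected ball into disjoint closed pieces. So each step gains a tile
until all are reached, and there are at most `M` of them. -/
theorem inter_ball_subset_chain {x : Tiling d} (hx : x ∈ X) {v : Euc d} {R : ℝ} {M : ℕ}
    (hM : {D ∈ x.tiles | (D ∩ Metric.ball v R).Nonempty}.encard ≤ M) {D : Set (Euc d)}
    (hD : D ∈ x.tiles) (hDv : (D ∩ Metric.ball v R).Nonempty) :
    {D ∈ x.tiles | (D ∩ Metric.ball v R).Nonempty} ⊆ X.chain D M := by
  set T := {D ∈ x.tiles | (D ∩ Metric.ball v R).Nonempty} with hT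
  have hTfin : T.Finite := finite_of_encard_le_coe hM
  have hDT : D ∈ T := ⟨hD, hDv⟩
  -- Every tile is its own neighbour, so the chains increase with their length.
  have hself : ∀ E ∈ T, E ∈ X.neighbors E := fun E hE =>
    ⟨x, hx, hE.1, hE.1, by rw [inter_self]; exact (x.isTile hE.1).nonempty⟩
  have hstep : ∀ k, T ∩ X.chain D k ⊆ T ∩ X.chain D (k + 1) := fun k E hE =>
    ⟨hE.1, mem_iUnion₂.2 ⟨E, hE.2, hself E hE.1⟩⟩
  have hmono : Monotone fun k => T ∩ X.chain D k := monotone_nat_of_le_succ hstep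
  have hclosed : ∀ {s : Set (Set (Euc d))}, s ⊆ T → IsClosed (⋃₀ s) := fun {s} hs => by
    rw [sUnion_eq_biUnion]
    exact (hTfin.subset hs).isClosed_biUnion fun E hE => (x.isTile (hs hE).1).isClosed
  -- a chain that does not grow any more exhausts the ball
  have hexhaust : ∀ k, T ∩ X.chain D k = T ∩ X.chain D (k + 1) → T ⊆ X.chain D k := by
    intro k hk
    by_contra hne
    obtain ⟨E, hET, hE⟩ := not_subset.1 hne
    have hpre : IsPreconnected (Metric.ball v R) := (convex_ball v R).isPreconnected
    rw [isPreconnected_closed_iff] at hpre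
    have h0 : D ∈ X.chain D k := (hmono (Nat.zero_le k) (⟨hDT, rfl⟩ : D ∈ T ∩ X.chain D 0)).2
    have hcov : Metric.ball v R ⊆ ⋃₀ (T ∩ X.chain D k) ∪ ⋃₀ (T \ X.chain D k) := by
      intro w hw
      obtain ⟨A, hA, hwA⟩ := x.exists_mem w
      have hAT : A ∈ T := ⟨hA, w, hwA, hw⟩
      by_cases hAk : A ∈ X.chain D k
      · exact Or.inl ⟨A, ⟨hAT, hAk⟩, hwA⟩
      · exact Or.inr ⟨A, ⟨hAT, hAk⟩, hwA⟩
    obtain ⟨u, huD, hu⟩ := hDv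
    obtain ⟨u', huE, hu'⟩ := hET.2
    obtain ⟨w, hw, ⟨A, hA, hwA⟩, ⟨B, hB, hwB⟩⟩ := hpre (⋃₀ (T ∩ X.chain D k))
      (⋃₀ (T \ X.chain D k)) (hclosed inter_subset_left) (hclosed sdiff_subset) hcov
      ⟨u, hu, D, ⟨hDT, h0⟩, huD⟩ ⟨u', hu', E, ⟨hET, hE⟩, huE⟩
    have : B ∈ T ∩ X.chain D (k + 1) :=
      ⟨hB.1, mem_iUnion₂.2 ⟨A, hA.2, x, hx, hA.1.1, hB.1.1, w, hwA, hwB⟩⟩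
    rw [← hk] at this
    exact hB.2 this.2
  -- before that, its length is bounded by the number of its tiles
  have hcard : ∀ k, T ⊆ X.chain D k ∨ ((k + 1 : ℕ) : ℕ∞) ≤ (T ∩ X.chain D k).encard := by
    intro k
    induction k with
    | zero =>
      right
      have : {D} ⊆ T ∩ X.chain D 0 := singleton_subset_iff.2 ⟨hDT, rfl⟩
      simpa using encard_le_encard this
    | succ k ih =>
      rcases ih with ih | ih
      · exact Or.inl fun E hE => (hstep k ⟨hE, ih hE⟩).2
      · by_cases hk : T ∩ X.chain D k = T ∩ X.chain D (k + 1)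
        · exact Or.inl fun E hE => (hstep k ⟨hE, hexhaust k hk hE⟩).2
        · right
          have := (hTfin.subset inter_subset_left).encard_lt_encard ((hstep k).ssubset_of_ne hk)
          have h2 := Order.add_one_le_of_lt (ih.trans_lt this)
          exact_mod_cast h2
  rcases hcard M with h | h
  · exact h
  · have := (h.trans (encard_le_encard inter_subset_left)).trans hM
    norm_cast at this
    omega

/-- A tiling is encoded by the type of a tile at the origin, the patch around the origin once this
tile is moved to standard position, and the approximate position of the origin in the prototile.
There are finitely many codes, and tilings with the same code agree near the origin up to a small
shift. -/
theorem IsPrototiles.totallyBounded (hP : X.IsPrototiles P) (hflc : X.HasFLC) :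
    @TotallyBounded X hP.hasBoundedTiles.uniformSpace univ := by
  let _ := hP.hasBoundedTiles.uniformSpace
  refine totallyBounded_univ_of_code (β := Fin l × Set (Set (Euc d)) × Euc d) fun V hV => ?_
  obtain ⟨ε, hε, hεV⟩ := hP.hasBoundedTiles.hasBasis.mem_iff.1 hV
  obtain ⟨M, hM⟩ := hP.exists_encard_le (1 / ε)
  have hnet : ∀ i, ∃ s : Set (Euc d), s.Finite ∧ P i ⊆ ⋃ c ∈ s, Metric.ball c (ε / 2) := fun i =>
    Metric.totallyBounded_iff.1 (isTile_of_mem (hP.mem i)).1.totallyBounded _ (by positivity)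
  choose s hs hsP using hnet
  have hcode : ∀ x : X, ∃ i : Fin l, ∃ t : Euc d, P i ∈ (-t +ᵥ x.1).tiles ∧ -t ∈ P i := fun x => by
    obtain ⟨D, hD, h0⟩ := x.1.exists_mem 0
    obtain ⟨i, t, rfl⟩ := hP.exists_equiv D ⟨x.1, x.2, hD⟩
    refine ⟨i, t, Tiling.mem_vadd.2 (by rwa [neg_neg]), ?_⟩
    rw [Set.mem_vadd_set_iff_neg_vadd_mem] at h0
    simpa using h0
  choose i t hit hti using hcode
  have hcen : ∀ x : X, ∃ c ∈ s (i x), -t x ∈ Metric.ball c (ε / 2) := fun x => by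
    simpa using hsP _ (hti x)
  choose c hc hct using hcen
  let A : X → Set (Set (Euc d)) := fun x =>
    {D ∈ (-t x +ᵥ x.1).tiles | (D ∩ Metric.ball (-t x) (1 / ε)).Nonempty}
  refine ⟨fun x => (i x, A x, c x), ?_, ?_⟩
  · have hfin : (⋃ j : Fin l, ({j} : Set (Fin l)) ×ˢ ((𝒫 (X.chain (P j) M)) ×ˢ (s j))).Finite :=
      finite_iUnion fun j => (finite_singleton j).prod
        ((hflc.finite_chain (hP.mem j) M).finite_subsets.prod (hs j))
    refine hfin.subset ?_
    rintro _ ⟨x, rfl⟩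
    refine mem_iUnion.2 ⟨i x, rfl, ?_, hc x⟩
    refine inter_ball_subset_chain (vadd_mem x.2) (hM _ (vadd_mem x.2) _) (hit x) ?_
    exact ⟨_, hti x, Metric.mem_ball_self (by positivity)⟩
  · intro x y hxy
    simp only [Prod.mk.injEq] at hxy
    obtain ⟨-, hA, hcc⟩ := hxy
    refine hεV ⟨t y - t x, ?_, fun D hD hDR => ?_⟩
    · have h1 := hct x
      have h2 := hct y
      rw [← hcc] at h2
      rw [Metric.mem_ball] at h1 h2
      have := dist_triangle_right (-t x) (-t y) (c x)
      rw [dist_eq_norm] at this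
      rw [show t y - t x = -t x - -t y by abel]
      linarith
    · have h1 : -t x +ᵥ D ∈ A x := by
        refine ⟨Tiling.vadd_mem_vadd.2 hD, ?_⟩
        obtain ⟨v, hv, hvR⟩ := hDR
        refine ⟨-t x +ᵥ v, Set.vadd_mem_vadd_set hv, ?_⟩
        rw [mem_ball_zero_iff] at hvR
        rwa [Metric.mem_ball, dist_eq_norm, vadd_eq_add, add_sub_cancel_left]
      rw [hA] at h1
      have h2 := Tiling.mem_vadd.1 h1.1
      rwa [← add_vadd, neg_neg, ← sub_eq_add_neg] at h2

/-- The uniformity is countably generated, so completeness may be tested on Cauchy sequences, and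
these are Cauchy for `d_T` as well. -/
theorem IsPrototiles.compactSpace (hP : X.IsPrototiles P) (hflc : X.HasFLC)
    (hX : X.IsComplete) : CompactSpace X := by
  let _ := hP.hasBoundedTiles.uniformSpace
  have hb := hP.hasBoundedTiles.hasBasis
  have := hP.hasBoundedTiles.isCountablyGenerated
  have hcomplete : CompleteSpace X := by
    refine UniformSpace.complete_of_cauchySeq_tendsto fun u hu => ?_
    obtain ⟨x, hx⟩ := hX u fun ε hε => by
      obtain ⟨δ, hδ, h⟩ := hP.hasBoundedTiles.exists_radius hε
      obtain ⟨N, hN⟩ := (hb.cauchySeq_iff.1 hu) δ hδ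
      exact ⟨N, fun m hm n hn => h _ (u m).2 _ (hN m hm n hn)⟩
    refine ⟨x, (nhds_basis_uniformity hb).tendsto_right_iff.2 fun ε hε => ?_⟩
    obtain ⟨N, hN⟩ := hx (min ε (√2 / 2)) (by positivity)
    filter_upwards [Filter.eventually_ge_atTop N] with n hn
    exact tilingEntourage_mono (by positivity) (min_le_left ε (√2 / 2))
      (exists_agree_of_tilingDist_lt (min_le_right _ _) (hN n hn))
  exact ⟨isCompact_iff_totallyBounded_isComplete.2
    ⟨hP.totallyBounded hflc, completeSpace_iff_isComplete_univ.1 hcomplete⟩⟩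

end TilingSpace

end MultiTiling

namespace MultiTiling

variable {d : ℕ}

/-! ### Inflations -/

theorem mem_substPatch {f : Set (Euc d) → Set (Set (Euc d))} {p : Set (Set (Euc d))}
    {E : Set (Euc d)} : E ∈ substPatch f p ↔ ∃ D ∈ p, E ∈ f D := by
  simp [substPatch]

theorem substPatch_mono {f : Set (Euc d) → Set (Set (Euc d))} {p q : Set (Set (Euc d))}
    (h : p ⊆ q) : substPatch f p ⊆ substPatch f q := biUnion_subset_biUnion_left h

theorem substPatch_substPatch (f g : Set (Euc d) → Set (Set (Euc d))) (p : Set (Set (Euc d))) :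
    substPatch f (substPatch g p) = substPatch (fun D => substPatch f (g D)) p := by
  ext E
  simp only [mem_substPatch]
  constructor
  · rintro ⟨D, ⟨D', h1, h2⟩, h3⟩; exact ⟨D', h1, D, h2, h3⟩
  · rintro ⟨D', h1, D, h2, h3⟩; exact ⟨D, ⟨D', h1, h2⟩, h3⟩

/-- A substitution whose dilatation factor may be `1`; these are closed under composition and
contain the identity. -/
@[ext]
structure Inflation (X : TilingSpace d) where
  toFun : Set (Euc d) → Set (Set (Euc d))
  dil : ℝ
  one_le_dil : 1 ≤ dil
  finite : ∀ D ∈ X.tileSet, (toFun D).Finite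
  support_eq : ∀ D ∈ X.tileSet, ⋃₀ toFun D = dil • D
  map_vadd : ∀ D ∈ X.tileSet, ∀ t : Euc d, toFun (t +ᵥ D) = (dil • t) +ᵥ toFun D
  extends_tilings : ∀ x ∈ X, ∃ h : IsTiling (substPatch toFun x.tiles),
    (⟨substPatch toFun x.tiles, h⟩ : Tiling d) ∈ X

/-- A substitution as an inflation. -/
def Substitution.toInflation {X : TilingSpace d} (S : Substitution X) : Inflation X where
  toFun := S.toFun
  dil := S.dil
  one_le_dil := S.one_lt_dil.le
  finite D hD := by
    obtain ⟨N, hN⟩ := mem_iUnion.1 (S.mem_patches D hD)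
    exact finite_of_encard_eq_coe hN.1
  support_eq := S.support_eq
  map_vadd := S.map_vadd
  extends_tilings := S.extends_tilings

namespace Inflation

variable {X : TilingSpace d}

theorem dil_pos (T : Inflation X) : 0 < T.dil := one_pos.trans_le T.one_le_dil

/-- The action of an inflation on the tilings of `X`. -/
def onTiling (T : Inflation X) (x : X) : X :=
  ⟨⟨substPatch T.toFun x.1.tiles, (T.extends_tilings x.1 x.2).1⟩, (T.extends_tilings x.1 x.2).2⟩

theorem mem_onTiling {T : Inflation X} {x : X} {E : Set (Euc d)} :
    E ∈ (T.onTiling x).1.tiles ↔ ∃ D ∈ x.1.tiles, E ∈ T.toFun D := mem_substPatch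

theorem mem_tileSet (T : Inflation X) {D E : Set (Euc d)} (hD : D ∈ X.tileSet)
    (hE : E ∈ T.toFun D) : E ∈ X.tileSet := by
  obtain ⟨x, hx, hDx⟩ := hD
  exact ⟨_, (T.onTiling ⟨x, hx⟩).2, mem_onTiling.2 ⟨D, hDx, hE⟩⟩

theorem subset_smul (T : Inflation X) {D E : Set (Euc d)} (hD : D ∈ X.tileSet)
    (hE : E ∈ T.toFun D) : E ⊆ T.dil • D := by
  rw [← T.support_eq D hD]
  exact subset_sUnion_of_mem hE

theorem nonempty (T : Inflation X) {D : Set (Euc d)} (hD : D ∈ X.tileSet) :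
    (T.toFun D).Nonempty := by
  obtain ⟨v, hv⟩ := (TilingSpace.isTile_of_mem hD).nonempty
  have := Set.smul_mem_smul_set (a := T.dil) hv
  rw [← T.support_eq D hD] at this
  obtain ⟨E, hE, -⟩ := this
  exact ⟨E, hE⟩

theorem vadd_mem (T : Inflation X) {D E : Set (Euc d)} (hD : D ∈ X.tileSet) {t : Euc d}
    (hE : E ∈ T.toFun D) : T.dil • t +ᵥ E ∈ T.toFun (t +ᵥ D) := by
  rw [T.map_vadd D hD]
  exact Set.vadd_mem_vadd_set hE

theorem substPatch_vadd (T : Inflation X) {q : Set (Set (Euc d))} (hq : q ⊆ X.tileSet)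
    (t : Euc d) : substPatch T.toFun (t +ᵥ q) = T.dil • t +ᵥ substPatch T.toFun q := by
  ext E
  rw [Set.mem_vadd_set_iff_neg_vadd_mem]
  simp only [mem_substPatch]
  constructor
  · rintro ⟨_, ⟨D, hD, rfl⟩, hE⟩
    refine ⟨D, hD, ?_⟩
    rwa [← Set.mem_vadd_set_iff_neg_vadd_mem, ← T.map_vadd D (hq hD)]
  · rintro ⟨D, hD, hE⟩
    refine ⟨t +ᵥ D, Set.vadd_mem_vadd_set hD, ?_⟩
    rwa [T.map_vadd D (hq hD), Set.mem_vadd_set_iff_neg_vadd_mem]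

theorem sUnion_substPatch (T : Inflation X) {q : Set (Set (Euc d))} (hq : q ⊆ X.tileSet) :
    ⋃₀ substPatch T.toFun q = T.dil • ⋃₀ q := by
  rw [Set.smul_set_sUnion]
  ext v
  simp only [mem_sUnion, mem_substPatch, mem_iUnion]
  constructor
  · rintro ⟨E, ⟨D, hD, hE⟩, hv⟩
    exact ⟨D, hD, T.subset_smul (hq hD) hE hv⟩
  · rintro ⟨D, hD, hv⟩
    rw [← T.support_eq D (hq hD)] at hv
    obtain ⟨E, hE, hvE⟩ := hv
    exact ⟨E, ⟨D, hD, hE⟩, hvE⟩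

theorem eq_of_inter (T : Inflation X) {x : X} {D D' E : Set (Euc d)} (hD : D ∈ x.1.tiles)
    (hD' : D' ∈ x.1.tiles) (hE : E ∈ T.toFun D')
    (h : (E ∩ interior (T.dil • D)).Nonempty) : D' = D := by
  obtain ⟨v, hvE, hv⟩ := h
  have h1 := T.subset_smul ⟨x.1, x.2, hD'⟩ hE hvE
  rw [interior_smul₀ T.dil_pos.ne'] at hv
  obtain ⟨u, hu, rfl⟩ := hv
  rw [Set.smul_mem_smul_set_iff₀ T.dil_pos.ne'] at h1
  exact x.1.eq_of_inter hD' hD h1 hu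

/-- Supertiles inherit the non-overlap of the tiles that produce them: a tile meeting the interior
of the supertile of `D` can only come from `D`. -/
theorem mem_of_inter (T : Inflation X) {x : X} {D E : Set (Euc d)} (hD : D ∈ x.1.tiles)
    (hE : E ∈ (T.onTiling x).1.tiles) (h : (E ∩ interior (T.dil • D)).Nonempty) :
    E ∈ T.toFun D := by
  obtain ⟨D', hD', hE'⟩ := mem_onTiling.1 hE
  rwa [← T.eq_of_inter hD hD' hE' h]

theorem agree (T : Inflation X) {R : ℝ} {t : Euc d} {x y : X} (h : Agree R t x.1 y.1) :
    Agree (T.dil * R) (T.dil • t) (T.onTiling x).1 (T.onTiling y).1 := by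
  rintro E hE ⟨v, hvE, hv⟩
  obtain ⟨D, hD, hED⟩ := mem_onTiling.1 hE
  have hDX : D ∈ X.tileSet := ⟨x.1, x.2, hD⟩
  obtain ⟨u, hu, rfl⟩ := T.subset_smul hDX hED hvE
  refine mem_onTiling.2 ⟨_, h D hD ⟨u, hu, ?_⟩, T.vadd_mem hDX hED⟩
  rw [mem_ball_zero_iff, norm_smul, Real.norm_of_nonneg T.dil_pos.le] at hv
  rw [mem_ball_zero_iff]
  exact lt_of_mul_lt_mul_left hv T.dil_pos.le

theorem onTiling_vadd (T : Inflation X) (t : Euc d) (x : X) :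
    T.onTiling (t +ᵥ x) = T.dil • t +ᵥ T.onTiling x :=
  Subtype.ext (Tiling.ext (T.substPatch_vadd (fun _ hD => ⟨x.1, x.2, hD⟩) t))

/-- The identity inflation. -/
protected def id (X : TilingSpace d) : Inflation X where
  toFun D := {D}
  dil := 1
  one_le_dil := le_rfl
  finite D _ := finite_singleton D
  support_eq D _ := by simp
  map_vadd D _ t := by simp
  extends_tilings x hx := by
    have : substPatch (fun D => {D}) x.tiles = x.tiles := biUnion_of_singleton x.tiles
    rw! [this]
    exact ⟨x.isTiling, hx⟩

/-- Composition of inflations. -/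
def comp (T U : Inflation X) : Inflation X where
  toFun D := substPatch T.toFun (U.toFun D)
  dil := T.dil * U.dil
  one_le_dil := one_le_mul_of_one_le_of_one_le T.one_le_dil U.one_le_dil
  finite D hD := (U.finite D hD).biUnion fun E hE => T.finite E (U.mem_tileSet hD hE)
  support_eq D hD := by
    rw [T.sUnion_substPatch fun E hE => U.mem_tileSet hD hE, U.support_eq D hD, mul_smul]
  map_vadd D hD t := by
    rw [U.map_vadd D hD, T.substPatch_vadd fun E hE => U.mem_tileSet hD hE, mul_smul]
  extends_tilings x hx := by
    have := substPatch_substPatch T.toFun U.toFun x.tiles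
    rw! [← this]
    exact ⟨(T.onTiling (U.onTiling ⟨x, hx⟩)).1.isTiling, (T.onTiling (U.onTiling ⟨x, hx⟩)).2⟩

theorem comp_assoc (T U V : Inflation X) : (T.comp U).comp V = T.comp (U.comp V) := by
  refine Inflation.ext (funext fun D => ?_) (mul_assoc _ _ _)
  exact (substPatch_substPatch _ _ _).symm

theorem comp_id (T : Inflation X) : T.comp (Inflation.id X) = T := by
  refine Inflation.ext (funext fun D => ?_) (mul_one _)
  exact biUnion_singleton D T.toFun

theorem id_comp (T : Inflation X) : (Inflation.id X).comp T = T := by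
  refine Inflation.ext (funext fun D => ?_) (one_mul _)
  exact biUnion_of_singleton (T.toFun D)

theorem onTiling_comp (T U : Inflation X) (x : X) :
    (T.comp U).onTiling x = T.onTiling (U.onTiling x) :=
  Subtype.ext (Tiling.ext (substPatch_substPatch _ _ _).symm)

end Inflation

/-! ### Iterated substitutions -/

variable {X : TilingSpace d} {J : Type*} {l : ℕ} {P : Fin l → Set (Euc d)}

/-- The inflation `S_{b₁} ∘ ⋯ ∘ S_{bₙ}`. -/
def iter (S : J → Substitution X) : (ℕ → J) → ℕ → Inflation X
  | _, 0 => Inflation.id X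
  | b, n + 1 => (S (b 0)).toInflation.comp (iter S (shift b) n)

theorem iter_add (S : J → Substitution X) (b : ℕ → J) (m n : ℕ) :
    iter S b (m + n) = (iter S b m).comp (iter S (shift^[m] b) n) := by
  induction m generalizing b with
  | zero => rw [zero_add]; exact (Inflation.id_comp _).symm
  | succ m ih =>
    rw [Nat.succ_add, iter, ih, iter, Inflation.comp_assoc, Function.iterate_succ_apply]

theorem iter_one (S : J → Substitution X) (b : ℕ → J) : iter S b 1 = (S (b 0)).toInflation :=
  Inflation.comp_id _

/-- Dependence on finitely many letters is what makes `Full` an open condition on the sequence. -/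
theorem iter_congr (S : J → Substitution X) {b b' : ℕ → J} {n : ℕ} (h : ∀ i < n, b i = b' i) :
    iter S b n = iter S b' n := by
  induction n generalizing b b' with
  | zero => rfl
  | succ n ih =>
    rw [iter, iter, h 0 (Nat.succ_pos n), ih (b := shift b) (b' := shift b')
      fun i hi => h (i + 1) (Nat.succ_lt_succ hi)]

theorem compPatch_eq (S : J → Substitution X) (b : ℕ → J) (n : ℕ) (D : Set (Euc d)) :
    compPatch S b n {D} = (iter S b n).toFun D := by
  induction n generalizing b with
  | zero => rfl
  | succ n ih => rw [compPatch, ih]; rfl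

theorem pow_le_dil_iter [Finite J] (S : J → Substitution X) :
    ∃ c > 1, ∀ b n, c ^ n ≤ (iter S b n).dil := by
  obtain ⟨c, hc, h⟩ : ∃ c : ℝ, 1 < c ∧ ∀ j, c ≤ (S j).dil := by
    rcases isEmpty_or_nonempty J with hJ | hJ
    · exact ⟨2, one_lt_two, fun j => hJ.elim j⟩
    · obtain ⟨j, hj⟩ := Finite.exists_min fun j => (S j).dil
      exact ⟨_, (S j).one_lt_dil, hj⟩
  refine ⟨c, hc, fun b n => ?_⟩
  induction n generalizing b with
  | zero => exact le_rfl
  | succ n ih =>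
    rw [pow_succ']
    exact mul_le_mul (h _) (ih _) (by positivity) (S (b 0)).toInflation.dil_pos.le

theorem dil_iter_le_pow [Finite J] (S : J → Substitution X) :
    ∃ c > 0, ∀ b n, (iter S b n).dil ≤ c ^ n := by
  obtain ⟨c, hc, h⟩ : ∃ c : ℝ, 0 < c ∧ ∀ j, (S j).dil ≤ c := by
    rcases isEmpty_or_nonempty J with hJ | hJ
    · exact ⟨2, two_pos, fun j => hJ.elim j⟩
    · obtain ⟨j, hj⟩ := Finite.exists_max fun j => (S j).dil
      exact ⟨_, one_pos.trans (S j).one_lt_dil, hj⟩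
  refine ⟨c, hc, fun b n => ?_⟩
  induction n generalizing b with
  | zero => exact le_rfl
  | succ n ih =>
    rw [pow_succ']
    exact mul_le_mul (h _) (ih _) (iter S (shift b) n).dil_pos.le hc.le

theorem tendsto_dil_iter [Finite J] (S : J → Substitution X) (b : ℕ → J) :
    Filter.Tendsto (fun n => (iter S b n).dil) Filter.atTop Filter.atTop := by
  obtain ⟨c, hc, h⟩ := pow_le_dil_iter S
  exact Filter.tendsto_atTop_mono (h b) (tendsto_pow_atTop_atTop_of_one_lt hc)

/-! ### Primitivity -/

/-- Every prototile occurs, up to translation, in the `k`-th iterate of every prototile. -/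
def Full (S : J → Substitution X) (P : Fin l → Set (Euc d)) (b : ℕ → J) (k : ℕ) : Prop :=
  ∀ i j, ∃ t : Euc d, t +ᵥ P i ∈ (iter S b k).toFun (P j)

/-- A positive entry of a product of nonnegative matrices has a positive path. The first matrix
belongs to the outermost substitution, so an intermediate type `m` is found in the inner iterate and
type `i` in the image of that tile. -/
theorem exists_mem_iter_of_prod_pos (hP : X.IsPrototiles P) (S : J → Substitution X)
    (k : ℕ) (b : ℕ → J) (i j : Fin l)
    (h : 0 < ((List.range k).map fun m => (S (b m)).structureMatrix P).prod i j) :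
    ∃ t : Euc d, t +ᵥ P i ∈ (iter S b k).toFun (P j) := by
  induction k generalizing b i with
  | zero =>
    have hij : i = j := by
      by_contra hne
      simp [hne] at h
    exact ⟨0, by rw [zero_vadd, hij]; rfl⟩
  | succ k ih =>
    rw [List.range_succ_eq_map, List.map_cons, List.prod_cons, Matrix.mul_apply] at h
    obtain ⟨m, -, hm⟩ := Finset.exists_ne_zero_of_sum_ne_zero h.ne'
    obtain ⟨h1, h2⟩ := mul_ne_zero_iff.1 hm
    rw [List.map_map] at h2
    obtain ⟨t, ht⟩ := ih (shift b) m (Nat.pos_of_ne_zero h2)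
    have h3 := (Set.nonempty_of_ncard_ne_zero h1)
    obtain ⟨E, hE, s, rfl⟩ := h3
    refine ⟨(S (b 0)).dil • t + s, ?_⟩
    rw [add_vadd]
    exact mem_substPatch.2 ⟨_, ht, (S (b 0)).toInflation.vadd_mem (hP.mem m) hE⟩

theorem PrimitiveSet.exists_full {S : J → Substitution X} (hS : PrimitiveSet S P)
    (hP : X.IsPrototiles P) (b : ℕ → J) : ∃ k, Full S P b k := by
  obtain ⟨N, hN⟩ := hS b 0
  refine ⟨N + 1, fun i j => exists_mem_iter_of_prod_pos hP S _ b i j ?_⟩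
  simpa only [matrixProd, zero_add] using hN i j

/-- The added substitution acts innermost: it turns `P j` into a nonempty patch, and the `k`-th
iterate of any one tile of that patch already contains all types. -/
theorem Full.succ {S : J → Substitution X} (hP : X.IsPrototiles P) {b : ℕ → J} {k : ℕ}
    (h : Full S P b k) : Full S P b (k + 1) := by
  intro i j
  rw [iter_add]
  set U := iter S (shift^[k] b) 1
  obtain ⟨E, hE⟩ := U.nonempty (hP.mem j)
  obtain ⟨m, s, rfl⟩ := hP.exists_equiv E (U.mem_tileSet (hP.mem j) hE)
  obtain ⟨t, ht⟩ := h i m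
  refine ⟨(iter S b k).dil • s + t, mem_substPatch.2 ⟨_, hE, ?_⟩⟩
  rw [add_vadd]
  exact (iter S b k).vadd_mem (hP.mem m) ht

theorem Full.mono {S : J → Substitution X} (hP : X.IsPrototiles P) {b : ℕ → J} {k k' : ℕ}
    (h : Full S P b k) (hk : k ≤ k') : Full S P b k' :=
  Nat.le_induction h (fun _ _ h => h.succ hP) k' hk

/-- The space `J^ℕ` is compact for finite discrete `J`, and the full sequences of length `k` form an
increasing open cover. -/
theorem PrimitiveSet.exists_forall_full [Finite J] {S : J → Substitution X}
    (hS : PrimitiveSet S P) (hP : X.IsPrototiles P) : ∃ k, ∀ b, Full S P b k := by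
  let _ : TopologicalSpace J := ⊥
  have : DiscreteTopology J := ⟨rfl⟩
  have hopen : ∀ k, IsOpen {b : ℕ → J | Full S P b k} := by
    intro k
    rw [isOpen_iff_forall_mem_open]
    intro b hb
    refine ⟨⋂ i ∈ Finset.range k, (fun b' : ℕ → J => b' i) ⁻¹' {b i}, fun b' hb' => ?_,
      isOpen_biInter_finset fun i _ => (isOpen_discrete _).preimage (continuous_apply i), ?_⟩
    · simp only [Finset.mem_range, mem_iInter, mem_preimage, mem_singleton_iff] at hb'
      change Full S P b' k
      intro i j
      rw [iter_congr S hb']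
      exact hb i j
    · simp
  obtain ⟨k, hk⟩ := isCompact_univ.elim_directed_cover _ hopen
    (fun b _ => mem_iUnion.2 (hS.exists_full hP b))
    (directed_of_isDirected_le fun m n hmn b hb => Full.mono hP hb hmn)
  exact ⟨k, fun b => hk (mem_univ b)⟩

end MultiTiling

namespace MultiTiling

variable {d : ℕ} {X : TilingSpace d} {J : Type*} {l : ℕ} {P : Fin l → Set (Euc d)}

/-! ### Multi-substitution tiling spaces -/

/-- By fullness, `m` further steps reproduce a translate of `D` inside its own iterate; applying the
first `k` substitutions to it embeds the `k`-th iterate in the `(k + m)`-th. This allows levels to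
be raised at will. -/
theorem Full.exists_vadd_subset {S : J → Substitution X} (hP : X.IsPrototiles P) {a : ℕ → J}
    {k m : ℕ} (h : Full S P (shift^[k] a) m) {D : Set (Euc d)} (hD : D ∈ X.tileSet) :
    ∃ t : Euc d, t +ᵥ (iter S a k).toFun D ⊆ (iter S a (k + m)).toFun D := by
  obtain ⟨j, s, rfl⟩ := hP.exists_equiv D hD
  obtain ⟨t, ht⟩ := h j j
  rw [iter_add]
  set U := iter S (shift^[k] a) m
  have h1 := U.vadd_mem (t := s) (hP.mem j) ht
  have h2 : (U.dil • s + t - s) +ᵥ (s +ᵥ P j) ∈ U.toFun (s +ᵥ P j) := by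
    rwa [← add_vadd, sub_add_cancel, add_vadd]
  refine ⟨(iter S a k).dil • (U.dil • s + t - s), fun E hE => ?_⟩
  refine mem_substPatch.2 ⟨_, h2, ?_⟩
  rwa [(iter S a k).map_vadd _ hD]

theorem mem_multiSpace_of {S : J → Substitution X} (hS : PrimitiveSet S P)
    (hP : X.IsPrototiles P) {a : ℕ → J} {D : Set (Euc d)} (hD : D ∈ X.tileSet) {x : Tiling d}
    (hx : x ∈ X) (h : ∀ p ⊆ x.tiles, p.Finite →
      ∃ k, ∃ t : Euc d, t +ᵥ p ⊆ (iter S a k).toFun D) : x ∈ multiSpace S a D := by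
  refine ⟨hx, fun p hp hpf => ?_⟩
  obtain ⟨k, t, ht⟩ := h p hp hpf
  obtain ⟨m, hm⟩ := hS.exists_full hP (shift^[k] a)
  -- Two extra levels lead past level 1, where `levelPatch` is `{D}` instead of an iterate.
  obtain ⟨s, hs⟩ := (hm.mono hP (Nat.le_add_right m 2)).exists_vadd_subset hP hD
  refine ⟨k + (m + 2), by omega, s + t, ?_⟩
  rw [levelPatch, if_neg (by omega), compPatch_eq, add_vadd]
  exact (Set.vadd_set_mono ht).trans hs

theorem exists_subset_iter {S : J → Substitution X} (hS : PrimitiveSet S P)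
    (hP : X.IsPrototiles P) {a : ℕ → J} {D : Set (Euc d)} (hD : D ∈ X.tileSet) {x : Tiling d}
    (hx : x ∈ multiSpace S a D) (n : ℕ) {p : Set (Set (Euc d))} (hp : p ⊆ x.tiles)
    (hpf : p.Finite) : ∃ k, ∃ t : Euc d, t +ᵥ p ⊆ (iter S a (n + k)).toFun D := by
  have h1 : ∃ k, ∃ t : Euc d, t +ᵥ p ⊆ (iter S a k).toFun D := by
    obtain ⟨k, -, t, ht⟩ := hx.2 p hp hpf
    by_cases hk : k = 1
    -- The exceptional patch at level 1 is the iterate of order 0.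
    · refine ⟨0, t, ?_⟩
      rwa [levelPatch, if_pos hk] at ht
    · refine ⟨k, t, ?_⟩
      rwa [levelPatch, if_neg hk, compPatch_eq] at ht
  obtain ⟨k, t, ht⟩ := h1
  obtain ⟨m, hm⟩ := hS.exists_full hP (shift^[k] a)
  obtain ⟨s, hs⟩ := (hm.mono hP (Nat.le_add_right m n)).exists_vadd_subset hP hD
  refine ⟨k + m, s + t, ?_⟩
  rw [add_vadd, show n + (k + m) = k + (m + n) by omega]
  exact (Set.vadd_set_mono ht).trans hs

/-! ### Limits of tilings: compactness, nonemptiness and desubstitution -/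

theorem exists_clusterPt_agree (hX : X.HasBoundedTiles) [CompactSpace X] (u : ℕ → X) :
    ∃ z : X, ∀ ε > 0, ∀ N, ∃ n ≥ N, (z.1, (u n).1) ∈ tilingEntourage d ε := by
  let _ := hX.uniformSpace
  obtain ⟨z, hz⟩ := exists_clusterPt_of_compactSpace (Filter.map u Filter.atTop)
  refine ⟨z, fun ε hε N => ?_⟩
  have h1 := (nhds_basis_uniformity' hX.hasBasis (x := z)).mem_of_mem (i := ε) hε
  exact Filter.frequently_atTop.1 (mapClusterPt_iff_frequently.1 hz _ h1) N

theorem exists_agree_of_entourage {x y : Tiling d} {ε R : ℝ} (hε : 0 < ε)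
    (hR : ε ≤ 1 / (|R| + 1)) (h : (x, y) ∈ tilingEntourage d ε) :
    ∃ s : Euc d, ‖s‖ ≤ 1 ∧ Agree R s x y := by
  obtain ⟨s, hs, h⟩ := h
  have h0 : 0 ≤ |R| := abs_nonneg R
  refine ⟨s, hs.trans (hR.trans ?_), h.mono ?_⟩
  · rw [div_le_one (by positivity)]; linarith
  · rw [le_div_iff₀ (by positivity)] at hR
    rw [le_div_iff₀ hε]
    nlinarith [le_abs_self R]

/-- A limit criterion: it suffices that on every ball `z` looks, up to a shift of norm at most 1,
like a patch occurring in some iterate of `D`. -/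
theorem mem_multiSpace_of_agree {S : J → Substitution X} (hS : PrimitiveSet S P)
    (hP : X.IsPrototiles P) {b : ℕ → J} {D : Set (Euc d)} (hD : D ∈ X.tileSet) {z : Tiling d}
    (hz : z ∈ X)
    (h : ∀ R : ℝ, ∃ z' : Tiling d, ∃ q ⊆ z'.tiles, Metric.ball 0 R ⊆ ⋃₀ q ∧
      (∃ k, ∃ t : Euc d, t +ᵥ q ⊆ (iter S b k).toFun D) ∧
      (∃ s : Euc d, ‖s‖ ≤ 1 ∧ Agree R s z z')) : z ∈ multiSpace S b D := by
  refine mem_multiSpace_of hS hP hD hz fun p hp hpf => ?_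
  have hbdd : Bornology.IsBounded (⋃₀ p) :=
    (Bornology.isBounded_sUnion hpf).2 fun E hE => (z.isTile (hp hE)).1.isBounded
  obtain ⟨R₀, hR₀⟩ := hbdd.subset_ball 0
  -- The extra unit of radius keeps the tiles of `p` inside the covered ball after the shift by `s`.
  obtain ⟨z', q, hq, hcov, ⟨k, t, ht⟩, s, hs, ha⟩ := h (R₀ + 1)
  refine ⟨k, t + s, ?_⟩
  rw [add_vadd]
  refine (Set.vadd_set_mono ?_).trans ht
  rintro _ ⟨E, hE, rfl⟩
  obtain ⟨v, hv⟩ := (z.isTile (hp hE)).nonempty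
  have hvR : ‖v‖ < R₀ := mem_ball_zero_iff.1 (hR₀ ⟨E, hE, hv⟩)
  have h1 := ha E (hp hE) ⟨v, hv, by rw [mem_ball_zero_iff]; linarith⟩
  refine z'.mem_of_subset hq h1 Metric.isOpen_ball hcov ⟨s + v, Set.vadd_mem_vadd_set hv, ?_⟩
  rw [mem_ball_zero_iff]
  linarith [norm_add_le s v]

theorem tileSet_multiSpace_subset (S : J → Substitution X) (a : ℕ → J) (D : Set (Euc d)) :
    (multiSpace S a D).tileSet ⊆ X.tileSet := by
  rintro E ⟨x, hx, hE⟩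
  exact ⟨x, hx.1, hE⟩

theorem hasBoundedTiles_multiSpace (hX : X.HasBoundedTiles) (S : J → Substitution X) (a : ℕ → J)
    (D : Set (Euc d)) : (multiSpace S a D).HasBoundedTiles := by
  obtain ⟨C, hC⟩ := hX
  exact ⟨C, fun E hE => hC E (tileSet_multiSpace_subset S a D hE)⟩

theorem compactSpace_multiSpace {S : J → Substitution X} (hS : PrimitiveSet S P)
    (hP : X.IsPrototiles P) (a : ℕ → J) {D : Set (Euc d)} (hD : D ∈ X.tileSet)
    [CompactSpace X] : CompactSpace (multiSpace S a D) := by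
  have hX := hP.hasBoundedTiles
  have hY := hasBoundedTiles_multiSpace hX S a D
  let i : multiSpace S a D → X := fun x => ⟨x.1, x.2.1⟩
  have hind : Topology.IsInducing i := by
    refine ⟨hY.topology_eq.trans ?_⟩
    refine Eq.trans ?_ (congrArg (TopologicalSpace.induced i) hX.topology_eq.symm)
    exact (induced_compose (tγ := (tilingUniformSpace d).toTopologicalSpace) (f := i)
      (g := ((↑) : X → Tiling d))).symm
  have hclosed : IsClosed (range i) := by
    let _ := hX.uniformSpace
    refine isClosed_of_closure_subset fun x hx => ?_
    rw [mem_closure_iff_nhds_basis (nhds_basis_uniformity' hX.hasBasis)] at hx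
    suffices h : x.1 ∈ multiSpace S a D from ⟨⟨x.1, h⟩, rfl⟩
    refine mem_multiSpace_of_agree hS hP hD x.2 fun R => ?_
    have hpos : (0 : ℝ) < 1 / (|R| + 1) := by positivity
    obtain ⟨_, ⟨z, rfl⟩, hz⟩ := hx _ hpos
    refine ⟨z.1, {E ∈ z.1.tiles | (E ∩ Metric.ball 0 R).Nonempty}, fun E hE => hE.1,
      fun v hv => ?_, ?_, exists_agree_of_entourage hpos le_rfl hz⟩
    · obtain ⟨E, hE, hvE⟩ := z.1.exists_mem v
      exact ⟨E, ⟨hE, v, hvE, hv⟩, hvE⟩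
    · obtain ⟨k, t, ht⟩ := exists_subset_iter hS hP hD z.2 0 (fun E hE => hE.1)
        (hP.finite_inter_ball z.2.1 0 R)
      exact ⟨0 + k, t, ht⟩
  have hemb : Topology.IsClosedEmbedding i :=
    ⟨⟨hind, fun x y h => Subtype.ext (congrArg (fun z : X => z.1) h)⟩, hclosed⟩
  exact hemb.compactSpace

/-- Centred at the image of an interior point of `D`, the iterates of `D` cover balls of radius
tending to infinity; any cluster point of these tilings belongs to the space. -/
theorem nonempty_multiSpace [Finite J] {S : J → Substitution X} (hS : PrimitiveSet S P)
    (hP : X.IsPrototiles P) (a : ℕ → J) {D : Set (Euc d)} (hD : D ∈ X.tileSet)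
    [CompactSpace X] : Nonempty (multiSpace S a D) := by
  obtain ⟨x, hx, hDx⟩ := id hD
  obtain ⟨v, hv⟩ := (x.isTile hDx).nonempty_interior
  obtain ⟨r, hr, hrD⟩ := Metric.isOpen_iff.1 isOpen_interior v hv
  obtain ⟨z, hz⟩ := exists_clusterPt_agree hP.hasBoundedTiles
    fun k => -((iter S a k).dil • v) +ᵥ (iter S a k).onTiling ⟨x, hx⟩
  refine ⟨z.1, mem_multiSpace_of_agree hS hP hD z.2 fun R => ?_⟩
  obtain ⟨N, hN⟩ := Filter.eventually_atTop.1 ((tendsto_dil_iter S a).eventually_ge_atTop (R / r))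
  have hpos : (0 : ℝ) < 1 / (|R| + 1) := by positivity
  obtain ⟨k, hk, hzk⟩ := hz _ hpos N
  refine ⟨_, -((iter S a k).dil • v) +ᵥ (iter S a k).toFun D, ?_, ?_,
    ⟨k, (iter S a k).dil • v, ?_⟩, exists_agree_of_entourage hpos le_rfl hzk⟩
  · exact Set.vadd_set_mono fun E hE => Inflation.mem_onTiling.2 ⟨D, hDx, hE⟩
  · intro w hw
    have hl := (iter S a k).dil_pos
    have h1 : v + (iter S a k).dil⁻¹ • w ∈ D := by
      refine interior_subset (hrD ?_)
      rw [Metric.mem_ball, dist_eq_norm, add_sub_cancel_left, norm_smul, norm_inv,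
        Real.norm_of_nonneg hl.le, inv_mul_lt_iff₀ hl]
      have := hN k hk
      rw [div_le_iff₀ hr] at this
      exact (mem_ball_zero_iff.1 hw).trans_le this
    have h2 := Set.smul_mem_smul_set (a := (iter S a k).dil) h1
    rw [← (iter S a k).support_eq D hD, smul_add, smul_inv_smul₀ hl.ne'] at h2
    obtain ⟨E, hE, hwE⟩ := h2
    refine ⟨_, Set.vadd_mem_vadd_set hE, ?_⟩
    rwa [Set.mem_vadd_set_iff_neg_vadd_mem, neg_neg]
  · rw [vadd_neg_vadd]

/-- A finite patch of the image is covered by the images of finitely many tiles of `x`. These occur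
together in an iterate of `D` along the shifted sequence, and prefixing the first `n` substitutions
gives an iterate along `a`. -/
theorem onTiling_iter_mem_multiSpace {S : J → Substitution X} (hS : PrimitiveSet S P)
    (hP : X.IsPrototiles P) {a : ℕ → J} {D : Set (Euc d)} (hD : D ∈ X.tileSet) (n : ℕ)
    {x : X} (hx : x.1 ∈ multiSpace S (shift^[n] a) D) :
    ((iter S a n).onTiling x).1 ∈ multiSpace S a D := by
  refine mem_multiSpace_of hS hP hD ((iter S a n).onTiling x).2 fun p hp hpf => ?_
  have h1 : ∀ E ∈ p, ∃ D' ∈ x.1.tiles, E ∈ (iter S a n).toFun D' := fun E hE =>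
    Inflation.mem_onTiling.1 (hp hE)
  choose! f hf hEf using h1
  obtain ⟨k, t, ht⟩ := exists_subset_iter hS hP hD hx 0 (p := f '' p)
    (image_subset_iff.2 hf) (hpf.image f)
  refine ⟨n + (0 + k), (iter S a n).dil • t, ?_⟩
  rw [iter_add]
  have h2 : p ⊆ substPatch (iter S a n).toFun (f '' p) := fun E hE =>
    mem_substPatch.2 ⟨_, mem_image_of_mem f hE, hEf E hE⟩
  refine (Set.vadd_set_mono h2).trans ?_
  rw [← Inflation.substPatch_vadd]
  · exact substPatch_mono ht
  · rintro _ ⟨E, hE, rfl⟩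
    exact ⟨x.1, x.2, hf E hE⟩

/-- The patch of `x` in the ball of radius `m` lies, up to translation, in `T` of an iterate of `D`,
so some tiling `z m` has an image agreeing with `x` on that ball. A cluster point of the `z m` is a
preimage of `x`, since `T` preserves agreement. -/
theorem exists_onTiling_iter_eq {S : J → Substitution X} (hS : PrimitiveSet S P)
    (hP : X.IsPrototiles P) {a : ℕ → J} {D : Set (Euc d)} (hD : D ∈ X.tileSet) (n : ℕ)
    [CompactSpace X] {x : Tiling d} (hx : x ∈ multiSpace S a D) :
    ∃ z : X, z.1 ∈ multiSpace S (shift^[n] a) D ∧ ((iter S a n).onTiling z).1 = x := by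
  set T := iter S a n with hT
  obtain ⟨x₀, hx₀, hDx⟩ := id hD
  have key : ∀ m : ℕ, ∃ z : X, ∃ q ⊆ z.1.tiles, Metric.ball 0 (m / T.dil) ⊆ ⋃₀ q ∧
      (∃ k, ∃ t : Euc d, t +ᵥ q ⊆ (iter S (shift^[n] a) k).toFun D) ∧
      Agree m 0 x (T.onTiling z).1 := by
    intro m
    obtain ⟨k, t, ht⟩ := exists_subset_iter hS hP hD hx n
      (p := {E ∈ x.tiles | (E ∩ Metric.ball 0 (m : ℝ)).Nonempty}) (fun E hE => hE.1)
      (hP.finite_inter_ball hx.1 0 m)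
    rw [iter_add] at ht
    set U := iter S (shift^[n] a) k
    have hDU : U.toFun D ⊆ X.tileSet := fun E hE => U.mem_tileSet hD hE
    have hq : {E ∈ x.tiles | (E ∩ Metric.ball 0 (m : ℝ)).Nonempty} ⊆
        substPatch T.toFun (T.dil⁻¹ • (-t) +ᵥ U.toFun D) := by
      rw [T.substPatch_vadd hDU, smul_inv_smul₀ T.dil_pos.ne']
      intro E hE
      rw [Set.mem_vadd_set_iff_neg_vadd_mem, neg_neg]
      exact ht (Set.vadd_mem_vadd_set hE)
    have hsub : T.dil⁻¹ • (-t) +ᵥ U.toFun D ⊆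
        (T.dil⁻¹ • (-t) +ᵥ U.onTiling ⟨x₀, hx₀⟩).1.tiles :=
      Set.vadd_set_mono fun E hE => Inflation.mem_onTiling.2 ⟨D, hDx, hE⟩
    -- The translation is divided by the dilatation so that after applying `T` it undoes `t`.
    refine ⟨T.dil⁻¹ • (-t) +ᵥ U.onTiling ⟨x₀, hx₀⟩, _, hsub, ?_, ⟨k, -(T.dil⁻¹ • (-t)), ?_⟩, ?_⟩
    · intro v hv
      have h1 : T.dil • v ∈ Metric.ball (0 : Euc d) m := by
        rw [mem_ball_zero_iff] at hv ⊢
        rwa [norm_smul, Real.norm_of_nonneg T.dil_pos.le, mul_comm, ← lt_div_iff₀ T.dil_pos]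
      obtain ⟨E, hE, hvE⟩ := x.exists_mem (T.dil • v)
      have h2 := subset_sUnion_of_mem (hq ⟨hE, _, hvE, h1⟩) hvE
      rw [T.sUnion_substPatch, Set.smul_mem_smul_set_iff₀ T.dil_pos.ne'] at h2
      · exact h2
      · rintro _ ⟨E, hE, rfl⟩
        exact TilingSpace.vadd_mem_tileSet (hDU hE) _
    · rw [neg_vadd_vadd]
    · intro E hE hEm
      rw [zero_vadd]
      exact substPatch_mono hsub (hq ⟨hE, hEm⟩)
  choose z q hqz hcov hqk hag using key
  obtain ⟨y, hy⟩ := exists_clusterPt_agree hP.hasBoundedTiles z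
  refine ⟨y, mem_multiSpace_of_agree hS hP hD y.2 fun R => ?_, ?_⟩
  · obtain ⟨N, hN⟩ := exists_nat_ge (R * T.dil)
    have hpos : (0 : ℝ) < 1 / (|R| + 1) := by positivity
    obtain ⟨m, hm, hym⟩ := hy _ hpos N
    refine ⟨_, q m, hqz m, ?_, hqk m, exists_agree_of_entourage hpos le_rfl hym⟩
    refine (Metric.ball_subset_ball ?_).trans (hcov m)
    rw [le_div_iff₀ T.dil_pos]
    exact hN.trans (by exact_mod_cast hm)
  · refine Tiling.eq_of_forall_agree fun ε hε => ?_
    obtain ⟨N, hN⟩ := exists_nat_ge (1 / ε + ε)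
    -- `T` multiplies shifts by its dilatation, hence the tolerance `ε / T.dil`; agreement radii
    -- only grow.
    obtain ⟨m, hm, s, hs, ha⟩ := hy (ε / T.dil) (div_pos hε T.dil_pos) N
    have h1 := T.agree ha
    have h2 := (hag m).symm
    rw [norm_zero, sub_zero, neg_zero] at h2
    have h3 : ‖T.dil • s‖ ≤ ε := by
      rw [norm_smul, Real.norm_of_nonneg T.dil_pos.le, mul_comm]
      rwa [le_div_iff₀ T.dil_pos] at hs
    have h4 : T.dil * (1 / (ε / T.dil)) = T.dil * T.dil * (1 / ε) := by
      have := T.dil_pos.ne'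
      field_simp
    have h5 : 1 / ε ≤ T.dil * T.dil * (1 / ε) :=
      le_mul_of_one_le_left (by positivity)
        (one_le_mul_of_one_le_of_one_le T.one_le_dil T.one_le_dil)
    refine ⟨T.dil • s, h3, ?_⟩
    have h6 : (N : ℝ) ≤ m := by exact_mod_cast hm
    have := (h1.mono (R' := 1 / ε) (by rw [h4]; exact h5)).trans h2 (by linarith)
    rwa [zero_add] at this

/-- The map `x ↦ S_{a₁}(x)` between the multi-substitution tiling spaces. -/
noncomputable def substMap {S : J → Substitution X} (hS : PrimitiveSet S P)
    (hP : X.IsPrototiles P) (a : ℕ → J) {D : Set (Euc d)} (hD : D ∈ X.tileSet)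
    (x : multiSpace S (shift a) D) : multiSpace S a D :=
  ⟨((S (a 0)).onTiling ⟨x.1, x.2.1⟩).1, by
    have := onTiling_iter_mem_multiSpace hS hP hD (a := a) 1 (x := ⟨x.1, x.2.1⟩) x.2
    rwa [iter_one] at this⟩

theorem continuous_substMap {S : J → Substitution X} (hS : PrimitiveSet S P)
    (hP : X.IsPrototiles P) (a : ℕ → J) {D : Set (Euc d)} (hD : D ∈ X.tileSet) :
    Continuous (substMap hS hP a hD) := by
  have h1 := hasBoundedTiles_multiSpace hP.hasBoundedTiles S a D
  have h2 := hasBoundedTiles_multiSpace hP.hasBoundedTiles S (shift a) D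
  let _ := h1.uniformSpace
  let _ := h2.uniformSpace
  refine UniformContinuous.continuous ((h2.hasBasis.uniformContinuous_iff h1.hasBasis).2 ?_)
  intro ε hε
  set T := (S (a 0)).toInflation
  refine ⟨ε / T.dil, div_pos hε T.dil_pos, ?_⟩
  rintro x y ⟨t, ht, h⟩
  have h3 := T.agree (x := ⟨x.1, x.2.1⟩) (y := ⟨y.1, y.2.1⟩) h
  refine ⟨T.dil • t, ?_, h3.mono ?_⟩
  · rw [norm_smul, Real.norm_of_nonneg T.dil_pos.le, mul_comm]
    rwa [le_div_iff₀ T.dil_pos] at ht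
  · have := T.dil_pos.ne'
    rw [show T.dil * (1 / (ε / T.dil)) = T.dil * T.dil * (1 / ε) by field_simp]
    exact le_mul_of_one_le_left (by positivity)
        (one_le_mul_of_one_le_of_one_le T.one_le_dil T.one_le_dil)

theorem bijective_substMap {S : J → Substitution X} (hS : PrimitiveSet S P)
    (hP : X.IsPrototiles P) (a : ℕ → J) {D : Set (Euc d)} (hD : D ∈ X.tileSet)
    [CompactSpace X] (hrec : (S (a 0)).Recognizable) :
    Function.Bijective (substMap hS hP a hD) := by
  constructor
  · intro x y h
    have h1 : (S (a 0)).onTiling ⟨x.1, x.2.1⟩ = (S (a 0)).onTiling ⟨y.1, y.2.1⟩ :=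
      Subtype.ext (congrArg (fun z : multiSpace S a D => z.1) h)
    exact Subtype.ext (congrArg (fun z : X => z.1) (hrec h1))
  · intro x
    obtain ⟨z, hz, hzx⟩ := exists_onTiling_iter_eq hS hP hD 1 x.2
    rw [iter_one] at hzx
    exact ⟨⟨z.1, hz⟩, Subtype.ext hzx⟩

theorem substMap_vadd {S : J → Substitution X} (hS : PrimitiveSet S P)
    (hP : X.IsPrototiles P) (a : ℕ → J) {D : Set (Euc d)} (hD : D ∈ X.tileSet) (t : Euc d)
    (x : multiSpace S (shift a) D) :
    substMap hS hP a hD (t +ᵥ x) = (S (a 0)).dil • t +ᵥ substMap hS hP a hD x :=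
  Subtype.ext (congrArg (fun z : X => z.1)
    ((S (a 0)).toInflation.onTiling_vadd t ⟨x.1, x.2.1⟩))

end MultiTiling

namespace MultiTiling

variable {d : ℕ}

/-! ### Unique ergodicity from uniform convergence of ball averages -/

section UniqueErgodicity

variable {Y : Type*} [AddAction (Euc d) Y]

/-- The average of `φ` along the part of the orbit of `x` given by the ball of radius `R`. -/
noncomputable def ballAvg (φ : Y → ℝ) (R : ℝ) (x : Y) : ℝ :=
  ⨍ t in Metric.ball (0 : Euc d) R, φ (-t +ᵥ x)

theorem ballAvg_const_mul (c : ℝ) (φ : Y → ℝ) (R : ℝ) (x : Y) :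
    ballAvg (d := d) (c • φ) R x = c * ballAvg (d := d) φ R x := by
  simp only [ballAvg, setAverage_eq, Pi.smul_apply, smul_eq_mul]
  rw [integral_const_mul]
  ring

theorem ballAvg_nonneg {φ : Y → ℝ} (h : ∀ x, 0 ≤ φ x) (R : ℝ) (x : Y) :
    0 ≤ ballAvg (d := d) φ R x := by
  simp only [ballAvg, setAverage_eq]
  exact smul_nonneg (by positivity) (integral_nonneg fun t => h _)

theorem ballAvg_vadd (φ : Y → ℝ) (s : Euc d) (R : ℝ) (x : Y) :
    ballAvg (d := d) (fun y => φ (s +ᵥ y)) R x = ballAvg (d := d) φ R (s +ᵥ x) := by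
  simp only [ballAvg, vadd_vadd, add_comm]

theorem ballAvg_const (c : ℝ) {R : ℝ} (hR : 0 < R) (x : Y) :
    ballAvg (d := d) (fun _ => c) R x = c := by
  simp only [ballAvg]
  exact setAverage_const (Metric.measure_ball_pos volume _ hR).ne' measure_ball_lt_top.ne c

variable [TopologicalSpace Y] [ContinuousVAdd (Euc d) Y]

theorem integrableOn_orbit {φ : Y → ℝ} (hφ : Continuous φ) (c : ℝ) (x : Y) {s : Set (Euc d)}
    (hs : Bornology.IsBounded s) : IntegrableOn (fun t : Euc d => φ (-(c • t) +ᵥ x)) s := by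
  have h1 : Continuous fun t : Euc d => φ (-(c • t) +ᵥ x) := by fun_prop
  exact (h1.continuousOn.integrableOn_compact hs.isCompact_closure).mono_set subset_closure

theorem integrableOn_ball_orbit {φ : Y → ℝ} (hφ : Continuous φ) (x : Y) (R : ℝ) :
    IntegrableOn (fun t : Euc d => φ (-t +ᵥ x)) (Metric.ball 0 R) := by
  simpa using integrableOn_orbit hφ 1 x (Metric.isBounded_ball (x := (0 : Euc d)) (r := R))

theorem ballAvg_add {φ ψ : Y → ℝ} (hφ : Continuous φ) (hψ : Continuous ψ) (R : ℝ) (x : Y) :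
    ballAvg (d := d) (φ + ψ) R x = ballAvg (d := d) φ R x + ballAvg (d := d) ψ R x := by
  simp only [ballAvg, setAverage_eq, Pi.add_apply]
  rw [integral_add (integrableOn_ball_orbit hφ x R) (integrableOn_ball_orbit hψ x R), smul_add]

variable [MeasurableSpace Y] [BorelSpace Y]

/-- Conditioning on an invariant set of positive measure gives an invariant probability measure; by
uniqueness it is `μ` itself, so the complement is null. -/
theorem ergodicVAdd_of_unique {μ : Measure Y} [IsProbabilityMeasure μ]
    [VAddInvariantMeasure (Euc d) Y μ]
    (huniq : ∀ ν : Measure Y, IsProbabilityMeasure ν → VAddInvariantMeasure (Euc d) Y ν → ν = μ) :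
    ErgodicVAdd (Euc d) Y μ := by
  refine ⟨fun {s} hs hinv => ?_⟩
  rw [Filter.eventuallyConst_set']
  by_cases h0 : μ s = 0
  · exact Or.inl (ae_eq_empty.2 h0)
  · right
    have hprob : IsProbabilityMeasure (ProbabilityTheory.cond μ s) :=
      ProbabilityTheory.cond_isProbabilityMeasure h0
    have hcond : VAddInvariantMeasure (Euc d) Y (ProbabilityTheory.cond μ s) := by
      refine ⟨fun g B hB => ?_⟩
      have hg : Measurable fun x : Y => g +ᵥ x := (continuous_const_vadd g).measurable
      rw [ProbabilityTheory.cond_apply hs, ProbabilityTheory.cond_apply hs]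
      congr 1
      rw [← measure_preimage_vadd μ g (s ∩ B)]
      exact measure_congr ((hinv g).symm.inter (ae_eq_refl _))
    have h1 := huniq _ hprob hcond
    rw [ae_eq_univ, ← h1, ProbabilityTheory.cond_apply hs, inter_compl_self]
    simp

variable [CompactSpace Y] [TopologicalSpace.PseudoMetrizableSpace Y]

theorem integrable_prod_orbit {φ : Y → ℝ} (hφ : Continuous φ) (ν : Measure Y)
    [IsProbabilityMeasure ν] (R : ℝ) :
    Integrable (Function.uncurry fun (x : Y) (t : Euc d) => φ (-t +ᵥ x))
      (ν.prod (volume.restrict (Metric.ball (0 : Euc d) R))) := by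
  have hsec : SecondCountableTopology Y := by
    let _ := TopologicalSpace.pseudoMetrizableSpacePseudoMetric Y
    infer_instance
  obtain ⟨C, hC⟩ := isCompact_univ.exists_bound_of_continuousOn hφ.continuousOn
  have hcont : Continuous (Function.uncurry fun (x : Y) (t : Euc d) => φ (-t +ᵥ x)) := by
    unfold Function.uncurry
    fun_prop
  have : IsFiniteMeasure (volume.restrict (Metric.ball (0 : Euc d) R)) :=
    ⟨by rw [Measure.restrict_apply_univ]; exact measure_ball_lt_top⟩
  exact Integrable.of_bound hcont.aestronglyMeasurable C
    (Filter.Eventually.of_forall fun p => hC _ (mem_univ _))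

theorem integrable_ballAvg {φ : Y → ℝ} (hφ : Continuous φ) (ν : Measure Y)
    [IsProbabilityMeasure ν] (R : ℝ) : Integrable (fun x => ballAvg (d := d) φ R x) ν := by
  simp only [ballAvg, setAverage_eq, smul_eq_mul]
  exact (integrable_prod_orbit (d := d) hφ ν R).integral_prod_left.const_mul _

theorem integral_ballAvg {φ : Y → ℝ} (hφ : Continuous φ) (ν : Measure Y)
    [IsProbabilityMeasure ν] [VAddInvariantMeasure (Euc d) Y ν] {R : ℝ} (hR : 0 < R) :
    ∫ x, ballAvg (d := d) φ R x ∂ν = ∫ x, φ x ∂ν := by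
  have hinv : ∀ t : Euc d, ∫ x, φ (-t +ᵥ x) ∂ν = ∫ x, φ x ∂ν := fun t =>
    (measurePreserving_vadd (-t) ν).integral_comp
      (Homeomorph.vadd (-t)).measurableEmbedding φ
  simp only [ballAvg, setAverage_eq, smul_eq_mul]
  rw [integral_const_mul, integral_integral_swap (integrable_prod_orbit (d := d) hφ ν R)]
  simp only [hinv]
  rw [← smul_eq_mul, ← setAverage_eq]
  exact setAverage_const (Metric.measure_ball_pos volume _ hR).ne' measure_ball_lt_top.ne _

/-- The limit of the ball averages is a positive, normalized linear functional, independent of the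
base point and therefore invariant; it is represented by a measure. Conversely an invariant `ν`
integrates `φ` and its ball averages equally, and the latter are uniformly close to the limit. -/
theorem exists_unique_ergodic [T2Space Y] [Nonempty Y]
    (H : ∀ φ : C(Y, ℝ), ∀ ε > 0, ∃ c R₀ : ℝ, ∀ R ≥ R₀, ∀ x, |ballAvg (d := d) φ R x - c| ≤ ε) :
    ∃ μ : Measure Y, IsProbabilityMeasure μ ∧ ErgodicVAdd (Euc d) Y μ ∧
      ∀ ν : Measure Y, IsProbabilityMeasure ν → VAddInvariantMeasure (Euc d) Y ν → ν = μ := by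
  obtain ⟨x₀⟩ := id ‹Nonempty Y›
  have hlim : ∀ φ : C(Y, ℝ), ∃ L : ℝ, ∀ ε > 0, ∃ R₀ : ℝ, ∀ R ≥ R₀, ∀ x,
      |ballAvg (d := d) φ R x - L| ≤ ε := by
    intro φ
    -- The constant `c` depends on `ε`, so the limit is obtained from the Cauchy property at one
    -- base point.
    have hcau : Cauchy (Filter.map (fun R => ballAvg (d := d) φ R x₀) Filter.atTop) := by
      refine Metric.cauchy_iff.2 ⟨inferInstance, fun ε hε => ?_⟩
      obtain ⟨c, R₀, h⟩ := H φ (ε / 3) (by positivity)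
      refine ⟨_, Filter.image_mem_map (Filter.Ici_mem_atTop R₀), ?_⟩
      rintro _ ⟨R, hR, rfl⟩ _ ⟨R', hR', rfl⟩
      have h1 := abs_le.1 (h R hR x₀)
      have h2 := abs_le.1 (h R' hR' x₀)
      rw [Real.dist_eq, abs_lt]
      constructor <;> linarith
    obtain ⟨L, hL⟩ := CompleteSpace.complete hcau
    refine ⟨L, fun ε hε => ?_⟩
    obtain ⟨c, R₀, h⟩ := H φ (ε / 2) (by positivity)
    have h1 : |L - c| ≤ ε / 2 := by
      have h2 : Filter.Tendsto (fun R => |ballAvg (d := d) φ R x₀ - c|) Filter.atTop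
          (nhds |L - c|) := (Filter.Tendsto.sub_const hL c).abs
      exact le_of_tendsto h2 ((Filter.eventually_ge_atTop R₀).mono fun R hR => h R hR x₀)
    refine ⟨R₀, fun R hR x => ?_⟩
    have h2 := abs_le.1 (h R hR x)
    have h3 := abs_le.1 h1
    rw [abs_le]
    constructor <;> linarith
  choose L hL using hlim
  have htend : ∀ (φ : C(Y, ℝ)) (x : Y), Filter.Tendsto (fun R => ballAvg (d := d) φ R x) Filter.atTop
      (nhds (L φ)) := fun φ x => by
    rw [Metric.tendsto_atTop]
    intro ε hε
    obtain ⟨R₀, h⟩ := hL φ (ε / 2) (by positivity)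
    exact ⟨R₀, fun R hR => by rw [Real.dist_eq]; linarith [h R hR x]⟩
  have hadd : ∀ φ ψ : C(Y, ℝ), L (φ + ψ) = L φ + L ψ := fun φ ψ =>
    tendsto_nhds_unique (htend _ x₀) (by
      have := (htend φ x₀).add (htend ψ x₀)
      simp only [← ballAvg_add (d := d) φ.continuous ψ.continuous] at this
      exact this)
  have hsmul : ∀ (c : ℝ) (φ : C(Y, ℝ)), L (c • φ) = c * L φ := fun c φ =>
    tendsto_nhds_unique (htend _ x₀) (by
      have := (htend φ x₀).const_mul c
      simp only [← ballAvg_const_mul (d := d)] at this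
      exact this)
  have hnonneg : ∀ φ : C(Y, ℝ), (∀ x, 0 ≤ φ x) → 0 ≤ L φ := fun φ h =>
    ge_of_tendsto' (htend φ x₀) fun R => ballAvg_nonneg h R x₀
  have hone : L 1 = 1 :=
    tendsto_nhds_unique (htend _ x₀) (tendsto_const_nhds.congr' (by
      filter_upwards [Filter.eventually_gt_atTop 0] with R hR
      exact (ballAvg_const 1 hR x₀).symm))
  -- Averaging `φ` composed with `s` at `x₀` is averaging `φ` at `s +ᵥ x₀`, and the limit does not
  -- see the base point.
  have hvadd : ∀ (s : Euc d) (φ ψ : C(Y, ℝ)), (∀ x, ψ x = φ (s +ᵥ x)) → L ψ = L φ :=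
    fun s φ ψ h => tendsto_nhds_unique (htend ψ x₀) (by
      have : (ψ : Y → ℝ) = fun x => φ (s +ᵥ x) := funext h
      simp only [this, ballAvg_vadd]
      exact htend φ _)
  let Λ : CompactlySupportedContinuousMap Y ℝ →ₚ[ℝ] ℝ := PositiveLinearMap.mk₀
    { toFun := fun f => L f.toContinuousMap
      map_add' := fun f g => hadd _ _
      map_smul' := fun c f => hsmul _ _ } fun f hf => hnonneg _ hf
  let μ := RealRMK.rieszMeasure Λ
  have hμ : ∀ φ : C(Y, ℝ), ∫ x, φ x ∂μ = L φ := fun φ =>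
    RealRMK.integral_rieszMeasure Λ ⟨φ, HasCompactSupport.of_compactSpace _⟩
  have hprob : IsProbabilityMeasure μ := by
    have h1 := hμ 1
    rw [hone] at h1
    simp only [ContinuousMap.one_apply, integral_const, smul_eq_mul, mul_one] at h1
    refine ⟨?_⟩
    rw [← ENNReal.toReal_eq_one_iff]
    exact h1
  have hext : ∀ ν : Measure Y, IsProbabilityMeasure ν → (∀ φ : C(Y, ℝ), ∫ x, φ x ∂ν = L φ) →
      ν = μ := fun ν _ h => by
    refine ext_of_forall_integral_eq_of_IsFiniteMeasure fun f => ?_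
    exact (h f.toContinuousMap).trans (hμ f.toContinuousMap).symm
  have hinv : VAddInvariantMeasure (Euc d) Y μ := by
    refine ⟨fun s B hB => ?_⟩
    have hs : Measurable fun x : Y => s +ᵥ x := (continuous_const_vadd s).measurable
    rw [← Measure.map_apply hs hB]
    congr 1
    refine hext _ (Measure.isProbabilityMeasure_map hs.aemeasurable) fun φ => ?_
    rw [integral_map hs.aemeasurable φ.continuous.aestronglyMeasurable]
    rw [← hvadd s φ ⟨fun x => φ (s +ᵥ x), φ.continuous.comp (continuous_const_vadd s)⟩ fun _ => rfl]
    exact hμ ⟨fun x => φ (s +ᵥ x), φ.continuous.comp (continuous_const_vadd s)⟩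
  have huniq : ∀ ν : Measure Y, IsProbabilityMeasure ν → VAddInvariantMeasure (Euc d) Y ν →
      ν = μ := by
    intro ν _ _
    refine hext ν ‹_› fun φ => ?_
    refine eq_of_forall_dist_le fun ε hε => ?_
    obtain ⟨R₀, h⟩ := hL φ ε hε
    have h2 : ∫ x, (ballAvg (d := d) φ (max R₀ 1) x - L φ) ∂ν = ∫ x, φ x ∂ν - L φ := by
      rw [integral_sub (integrable_ballAvg φ.continuous ν _) (integrable_const _),
        integral_ballAvg φ.continuous ν (by positivity)]
      simp
    rw [Real.dist_eq, ← h2]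
    have := norm_integral_le_of_norm_le_const (μ := ν) (C := ε)
      (f := fun x => ballAvg (d := d) φ (max R₀ 1) x - L φ)
      (Filter.Eventually.of_forall fun x => h _ (le_max_left _ _) x)
    simpa using this
  exact ⟨μ, hprob, ergodicVAdd_of_unique huniq, huniq⟩

end UniqueErgodicity

end MultiTiling

namespace MultiTiling

variable {d : ℕ} {X : TilingSpace d} {l : ℕ} {P : Fin l → Set (Euc d)}

/-! ### Volumes of tiles -/

theorem IsTile.volume_ne_top {D : Set (Euc d)} (h : IsTile D) : volume D ≠ ⊤ :=
  h.1.measure_lt_top.ne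

theorem IsTile.volume_interior_ne_top {D : Set (Euc d)} (h : IsTile D) :
    volume (interior D) ≠ ⊤ :=
  ((measure_mono interior_subset).trans_lt h.1.measure_lt_top).ne

theorem volume_real_vadd (D : Set (Euc d)) (t : Euc d) :
    volume.real (t +ᵥ D) = volume.real D := by
  rw [measureReal_def, TilingSpace.volume_vadd, measureReal_def]

theorem volume_real_smul {c : ℝ} (hc : 0 < c) (D : Set (Euc d)) :
    volume.real (c • D) = c ^ d * volume.real D := by
  rw [measureReal_def, Measure.addHaar_smul, ENNReal.toReal_mul, measureReal_def,
    abs_of_pos (by positivity), ENNReal.toReal_ofReal (by positivity), finrank_euclideanSpace_fin]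

theorem IsTile.volume_interior_pos {D : Set (Euc d)} (h : IsTile D) :
    0 < volume.real (interior D) :=
  ENNReal.toReal_pos (isOpen_interior.measure_pos _ h.nonempty_interior).ne'
    h.volume_interior_ne_top

namespace Inflation

theorem interior_subset_smul (T : Inflation X) {D E : Set (Euc d)} (hD : D ∈ X.tileSet)
    (hE : E ∈ T.toFun D) : interior E ⊆ T.dil • interior D := by
  rw [← interior_smul₀ T.dil_pos.ne']
  exact interior_mono (T.subset_smul hD hE)

theorem exists_tiling (T : Inflation X) {D : Set (Euc d)} (hD : D ∈ X.tileSet) :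
    ∃ x ∈ X, T.toFun D ⊆ x.tiles := by
  obtain ⟨x, hx, hDx⟩ := hD
  exact ⟨_, (T.onTiling ⟨x, hx⟩).2, fun E hE => mem_onTiling.2 ⟨D, hDx, hE⟩⟩

end Inflation

/-- The boundary of the inflated tile is covered by the boundaries of the small tiles, because their
interiors lie in the inflated interior. The tile `E₀` stays away from this boundary and can be left
out, which is the gain. -/
theorem volume_frontier_le_of_interior_tile (T : Inflation X) {D E₀ : Set (Euc d)}
    (hD : D ∈ X.tileSet) (hE₀ : E₀ ∈ T.toFun D) (hE₀D : E₀ ⊆ T.dil • interior D) {M : ℝ}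
    (hM0 : 0 ≤ M)
    (hM : ∀ E ∈ X.tileSet, volume.real (E \ interior E) ≤ M * volume.real (interior E)) :
    T.dil ^ d * volume.real (D \ interior D) ≤
      M * (T.dil ^ d * volume.real (interior D) - volume.real (interior E₀)) := by
  classical
  obtain ⟨x, hx, hTx⟩ := T.exists_tiling hD
  set F := (T.finite D hD).toFinset with hF
  have hmem : ∀ {E}, E ∈ F ↔ E ∈ T.toFun D := (T.finite D hD).mem_toFinset
  have hDt := TilingSpace.isTile_of_mem hD
  have htile : ∀ {E}, E ∈ F → IsTile E := fun hE => x.isTile (hTx (hmem.1 hE))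
  have h1 : T.dil • (D \ interior D) ⊆ ⋃ E ∈ F.erase E₀, (E \ interior E) := by
    rintro _ ⟨v, ⟨hvD, hv⟩, rfl⟩
    have h2 := Set.smul_mem_smul_set (a := T.dil) hvD
    rw [← T.support_eq D hD] at h2
    obtain ⟨E, hE, hvE⟩ := h2
    have hout : T.dil • v ∉ T.dil • interior D := by
      rwa [Set.smul_mem_smul_set_iff₀ T.dil_pos.ne']
    refine mem_iUnion₂.2 ⟨E, Finset.mem_erase.2 ⟨?_, hmem.2 hE⟩, hvE, fun h => hout ?_⟩
    · rintro rfl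
      exact hout (hE₀D hvE)
    · exact T.interior_subset_smul hD hE h
  have h2 : volume.real (⋃ E ∈ F, interior E) = ∑ E ∈ F, volume.real (interior E) := by
    refine measureReal_biUnion_finset (fun E hE E' hE' hne => ?_)
      (fun E _ => isOpen_interior.measurableSet) fun E hE => (htile hE).volume_interior_ne_top
    exact x.isTiling.1.2 (hTx (hmem.1 hE)) (hTx (hmem.1 hE')) hne
  have h3 : ∑ E ∈ F, volume.real (interior E) ≤ T.dil ^ d * volume.real (interior D) := by
    rw [← h2, ← volume_real_smul T.dil_pos]
    refine measureReal_mono (iUnion₂_subset fun E hE =>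
      T.interior_subset_smul hD (hmem.1 hE)) ?_
    rw [Measure.addHaar_smul]
    exact ENNReal.mul_ne_top ENNReal.ofReal_ne_top hDt.volume_interior_ne_top
  have hfin : volume (⋃ E ∈ F.erase E₀, (E \ interior E)) ≠ ⊤ := by
    refine ((measure_biUnion_finset_le _ _).trans_lt (ENNReal.sum_lt_top.2 fun E hE => ?_)).ne
    exact (measure_mono sdiff_subset).trans_lt
      (htile (Finset.mem_of_mem_erase hE)).1.measure_lt_top
  calc T.dil ^ d * volume.real (D \ interior D)
      = volume.real (T.dil • (D \ interior D)) := (volume_real_smul T.dil_pos _).symm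
    _ ≤ volume.real (⋃ E ∈ F.erase E₀, (E \ interior E)) := measureReal_mono h1 hfin
    _ ≤ ∑ E ∈ F.erase E₀, volume.real (E \ interior E) := measureReal_biUnion_finset_le _ _
    _ ≤ ∑ E ∈ F.erase E₀, M * volume.real (interior E) := Finset.sum_le_sum fun E hE =>
        hM E (T.mem_tileSet hD (hmem.1 (Finset.mem_of_mem_erase hE)))
    _ = M * (∑ E ∈ F, volume.real (interior E) - volume.real (interior E₀)) := by
        rw [← Finset.mul_sum, ← Finset.sum_erase_add _ _ (hmem.2 hE₀), add_sub_cancel_right]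
    _ ≤ _ := mul_le_mul_of_nonneg_left (by linarith) hM0

/-- The boundary of a tile has measure zero. -/
theorem Substitution.volume_boundary (S : Substitution X) (hP : X.IsPrototiles P)
    {D : Set (Euc d)} (hD : D ∈ X.tileSet) : volume (D \ interior D) = 0 := by
  obtain ⟨C, hC0, hC⟩ := hP.exists_diam_le
  have hne : Nonempty (Fin l) := by
    obtain ⟨i, -⟩ := hP.exists_equiv D hD
    exact ⟨i⟩
  -- Take the prototile with the largest ratio `M` of boundary volume to interior volume. Applied to
  -- it, the preceding estimate loses a multiple of `M`, so `M` must vanish.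
  obtain ⟨i, hi⟩ := Finite.exists_max fun i =>
    volume.real (P i \ interior (P i)) / volume.real (interior (P i))
  set M := volume.real (P i \ interior (P i)) / volume.real (interior (P i)) with hMdef
  have hpos : ∀ j, 0 < volume.real (interior (P j)) := fun j =>
    (TilingSpace.isTile_of_mem (hP.mem j)).volume_interior_pos
  have hM0 : 0 ≤ M := by positivity
  have hM : ∀ E ∈ X.tileSet, volume.real (E \ interior E) ≤ M * volume.real (interior E) := by
    intro E hE
    obtain ⟨j, t, rfl⟩ := hP.exists_equiv E hE
    rw [interior_vadd, ← Set.vadd_set_sdiff, volume_real_vadd, volume_real_vadd]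
    exact (div_le_iff₀ (hpos j)).1 (hi j)
  have hit := TilingSpace.isTile_of_mem (hP.mem i)
  obtain ⟨v, hv⟩ := hit.nonempty_interior
  obtain ⟨r, hr, hrD⟩ := Metric.isOpen_iff.1 isOpen_interior v hv
  -- Once the inflated ball has radius above the diameter bound `C`, the tile containing its centre
  -- stays inside it.
  obtain ⟨n, hn⟩ := ((tendsto_dil_iter (fun _ : Unit => S) fun _ => ()).eventually_gt_atTop
    (C / r)).exists
  set T := iter (fun _ : Unit => S) (fun _ => ()) n
  have h1 := Set.smul_mem_smul_set (a := T.dil) (interior_subset hv)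
  rw [← T.support_eq _ (hP.mem i)] at h1
  obtain ⟨E₀, hE₀, hvE⟩ := h1
  have hE₀X := T.mem_tileSet (hP.mem i) hE₀
  have hE₀t := TilingSpace.isTile_of_mem hE₀X
  have h2 : E₀ ⊆ T.dil • interior (P i) := by
    intro w hw
    rw [Set.mem_smul_set_iff_inv_smul_mem₀ T.dil_pos.ne']
    refine hrD ?_
    have h3 := (Metric.dist_le_diam_of_mem hE₀t.1.isBounded hw hvE).trans (hC _ hE₀X)
    have h4 : T.dil⁻¹ • w - v = T.dil⁻¹ • (w - T.dil • v) := by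
      rw [smul_sub, inv_smul_smul₀ T.dil_pos.ne']
    rw [Metric.mem_ball, dist_eq_norm, h4, norm_smul, norm_inv,
      Real.norm_of_nonneg T.dil_pos.le, inv_mul_lt_iff₀ T.dil_pos, ← dist_eq_norm]
    rw [div_lt_iff₀ hr] at hn
    linarith
  have h3 := volume_frontier_le_of_interior_tile T (hP.mem i) hE₀ h2 hM0 hM
  have h4 : volume.real (P i \ interior (P i)) = M * volume.real (interior (P i)) := by
    rw [hMdef, div_mul_cancel₀ _ (hpos i).ne']
  rw [h4] at h3
  have h5 := hE₀t.volume_interior_pos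
  have h6 : M = 0 := by
    by_contra hne
    have : 0 < M := lt_of_le_of_ne hM0 (Ne.symm hne)
    have := mul_pos this h5
    nlinarith
  have h7 := hM D hD
  rw [h6, zero_mul] at h7
  have h8 : volume (D \ interior D) ≠ ⊤ :=
    ((measure_mono sdiff_subset).trans_lt (TilingSpace.isTile_of_mem hD).1.measure_lt_top).ne
  exact (measureReal_eq_zero_iff h8).1 (le_antisymm h7 measureReal_nonneg)

variable (X) in
/-- The boundaries of the tiles have measure zero. -/
def TilingSpace.HasNullBoundaries : Prop := ∀ D ∈ X.tileSet, volume (D \ interior D) = 0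

theorem Tiling.aedisjoint (hX : X.HasNullBoundaries) {x : Tiling d} (hx : x ∈ X)
    {D E : Set (Euc d)} (hD : D ∈ x.tiles) (hE : E ∈ x.tiles) (hne : D ≠ E) :
    AEDisjoint volume D E := by
  refine measure_mono_null (t := D \ interior D) ?_ (hX D ⟨x, hx, hD⟩)
  rintro v ⟨hvD, hvE⟩
  exact ⟨hvD, fun h => hne (x.eq_of_inter hE hD hvE h).symm⟩

theorem integral_tiles (hX : X.HasNullBoundaries) {x : Tiling d} (hx : x ∈ X)
    (F : Finset (Set (Euc d))) (hF : (F : Set (Set (Euc d))) ⊆ x.tiles) {h : Euc d → ℝ}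
    (hint : IntegrableOn h (⋃ E ∈ F, E)) :
    ∫ v in ⋃ E ∈ F, E, h v = ∑ E ∈ F, ∫ v in E, h v := by
  have hU : (⋃ E ∈ F, E) = ⋃ E : F, (E : Set (Euc d)) := by
    rw [iUnion_subtype]
  rw [hU] at hint ⊢
  rw [integral_iUnion_ae (fun E => (x.isTile (hF E.2)).isClosed.nullMeasurableSet)
    (fun E E' hne => Tiling.aedisjoint hX hx (hF E.2) (hF E'.2) fun h => hne (Subtype.ext h)) hint,
    tsum_fintype]
  exact Finset.sum_coe_sort F fun E => ∫ v in E, h v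

theorem volume_tiles (hX : X.HasNullBoundaries) {x : Tiling d} (hx : x ∈ X)
    (F : Finset (Set (Euc d))) (hF : (F : Set (Set (Euc d))) ⊆ x.tiles) :
    volume.real (⋃ E ∈ F, E) = ∑ E ∈ F, volume.real E :=
  measureReal_biUnion_finset₀ (fun _ hE _ hE' hne => Tiling.aedisjoint hX hx (hF hE) (hF hE') hne)
    (fun _ hE => (x.isTile (hF hE)).isClosed.nullMeasurableSet)
    fun _ hE => (x.isTile (hF hE)).volume_ne_top

/-- The points of `E` at distance less than `ρ` from the complement of its interior fill only a
small part of `E`, uniformly over the tiles. -/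
theorem exists_volume_collar_le (hP : X.IsPrototiles P) (hX : X.HasNullBoundaries) {ε : ℝ}
    (hε : 0 < ε) : ∃ ρ > 0, ∀ E ∈ X.tileSet,
      volume.real (E ∩ Metric.thickening ρ (interior E)ᶜ) ≤ ε * volume.real E := by
  have hproto : ∀ i, ∀ᶠ ρ in nhdsWithin (0 : ℝ) (Ioi 0),
      volume.real (P i ∩ Metric.thickening ρ (interior (P i))ᶜ) ≤ ε * volume.real (P i) := by
    intro i
    have hit := TilingSpace.isTile_of_mem (hP.mem i)
    have hfin : IsFiniteMeasure (volume.restrict (P i)) :=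
      ⟨by rw [Measure.restrict_apply_univ]; exact hit.1.measure_lt_top⟩
    -- The thickenings shrink to the closed complement of the interior, which meets the tile in a
    -- null set. Restricting to the tile supplies the required finiteness.
    have h1 := tendsto_measure_thickening (μ := volume.restrict (P i)) (s := (interior (P i))ᶜ)
      ⟨1, one_pos, measure_ne_top _ _⟩
    rw [isOpen_interior.isClosed_compl.closure_eq,
      Measure.restrict_apply isOpen_interior.isClosed_compl.measurableSet, inter_comm,
      ← sdiff_eq, hX _ (hP.mem i)] at h1
    have hpos : 0 < ENNReal.ofReal (ε * volume.real (P i)) := by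
      rw [ENNReal.ofReal_pos]
      have h2 := hit.volume_interior_pos.trans_le
        (measureReal_mono interior_subset hit.volume_ne_top)
      positivity
    filter_upwards [h1.eventually_lt_const hpos] with ρ hρ
    rw [Measure.restrict_apply Metric.isOpen_thickening.measurableSet, inter_comm] at hρ
    rw [measureReal_def]
    exact ENNReal.toReal_le_of_le_ofReal (by positivity) hρ.le
  obtain ⟨ρ, hρ, hρ0⟩ := ((Filter.eventually_all.2 hproto).and self_mem_nhdsWithin).exists
  refine ⟨ρ, hρ0, fun E hE => ?_⟩
  obtain ⟨i, t, rfl⟩ := hP.exists_equiv E hE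
  have h1 : (t +ᵥ P i) ∩ Metric.thickening ρ (interior (t +ᵥ P i))ᶜ =
      t +ᵥ (P i ∩ Metric.thickening ρ (interior (P i))ᶜ) := by
    have h2 : Metric.thickening ρ (interior (t +ᵥ P i))ᶜ =
        t +ᵥ Metric.thickening ρ (interior (P i))ᶜ := by
      rw [interior_vadd, ← Set.vadd_set_compl]
      ext v
      rw [Set.mem_vadd_set_iff_neg_vadd_mem, Metric.mem_thickening_iff, Metric.mem_thickening_iff]
      constructor
      · rintro ⟨_, ⟨z, hz, rfl⟩, h⟩
        refine ⟨z, hz, ?_⟩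
        rwa [← dist_vadd_cancel_left t, vadd_neg_vadd]
      · rintro ⟨z, hz, h⟩
        refine ⟨t +ᵥ z, Set.vadd_mem_vadd_set hz, ?_⟩
        rwa [← dist_vadd_cancel_left t, vadd_neg_vadd] at h
    rw [h2, Set.vadd_set_inter]
  rw [h1, volume_real_vadd, volume_real_vadd]
  exact hρ i

end MultiTiling

namespace MultiTiling

variable {d : ℕ}

/-! ### Averages over supertiles -/

/-- Shifting by the fixed `t₀` costs `‖t₀‖` of agreement radius, while the remainder `t - t₀` is
absorbed into the small translation. -/
theorem TilingSpace.HasBoundedTiles.continuousVAdd {Y : TilingSpace d} (hY : Y.HasBoundedTiles) :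
    ContinuousVAdd (Euc d) Y := by
  let _ := hY.uniformSpace
  refine ⟨continuous_iff_continuousAt.2 ?_⟩
  rintro ⟨t₀, x₀⟩
  have hb := Metric.nhds_basis_ball (x := t₀) |>.prod_nhds
    (nhds_basis_uniformity' hY.hasBasis (x := x₀))
  refine (hb.tendsto_iff (nhds_basis_uniformity' hY.hasBasis)).2 fun ε hε => ?_
  have h1 : 0 < 1 / (1 / ε + ‖t₀‖) := by positivity
  refine ⟨(ε / 2, min (ε / 2) (1 / (1 / ε + ‖t₀‖))), ⟨by positivity, by positivity⟩, ?_⟩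
  rintro ⟨t, x⟩ ⟨ht, s, hs, h⟩
  have ht' : ‖t - t₀‖ < ε / 2 := by rwa [← dist_eq_norm]
  have h2 : 1 / ε + ‖t₀‖ ≤ 1 / min (ε / 2) (1 / (1 / ε + ‖t₀‖)) := by
    rw [le_div_iff₀ (by positivity)]
    have := min_le_right (ε / 2) (1 / (1 / ε + ‖t₀‖))
    rwa [le_div_iff₀ (by positivity), mul_comm] at this
  have h3 := ((h.vadd t₀).mono (R' := 1 / ε) (by linarith)).trans
    (agree_vadd (1 / ε + ‖s‖) (t - t₀) (t₀ +ᵥ x.1)) le_rfl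
  rw [vadd_vadd, sub_add_cancel] at h3
  refine ⟨t - t₀ + s, ?_, h3⟩
  have := hs.trans (min_le_left _ _)
  linarith [norm_add_le (t - t₀) s]

variable {X : TilingSpace d} {l : ℕ} {P : Fin l → Set (Euc d)}

/-- The window of radius `R` around `T.dil • v` lies inside the supertile of `E`, so what is seen
there depends only on the type of `E`. -/
theorem Inflation.agree_of_ball_subset (T : Inflation X) {y y' : X} {E : Set (Euc d)}
    (hE : E ∈ y.1.tiles) {s : Euc d} (hE' : s +ᵥ E ∈ y'.1.tiles) {v : Euc d} {ρ R : ℝ}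
    (hv : Metric.ball v ρ ⊆ interior E) (hR : R ≤ T.dil * ρ) :
    Agree R 0 (-(T.dil • v) +ᵥ (T.onTiling y).1)
      (-(T.dil • (s + v)) +ᵥ (T.onTiling y').1) := by
  intro F hF hFR
  rw [zero_vadd, Tiling.mem_vadd, neg_neg]
  rw [Tiling.mem_vadd, neg_neg] at hF
  have hEX : E ∈ X.tileSet := ⟨y.1, y.2, hE⟩
  have h1 : T.dil • v +ᵥ F ∈ T.toFun E := by
    refine T.mem_of_inter hE hF ?_
    obtain ⟨u, hu, huR⟩ := hFR
    refine ⟨T.dil • v + u, Set.vadd_mem_vadd_set hu, ?_⟩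
    rw [interior_smul₀ T.dil_pos.ne', Set.mem_smul_set_iff_inv_smul_mem₀ T.dil_pos.ne', smul_add,
      inv_smul_smul₀ T.dil_pos.ne']
    refine hv ?_
    rw [Metric.mem_ball, dist_eq_norm, add_sub_cancel_left, norm_smul, norm_inv,
      Real.norm_of_nonneg T.dil_pos.le, inv_mul_lt_iff₀ T.dil_pos]
    exact (mem_ball_zero_iff.1 huR).trans_le hR
  have h2 := T.vadd_mem hEX (t := s) h1
  rw [vadd_vadd, ← smul_add] at h2
  exact Inflation.mem_onTiling.2 ⟨_, hE', h2⟩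

theorem Inflation.volume_sum (T : Inflation X) (hX : X.HasNullBoundaries) {E : Set (Euc d)}
    (hE : E ∈ X.tileSet) :
    ∑ F ∈ (T.finite E hE).toFinset, volume.real F = T.dil ^ d * volume.real E := by
  obtain ⟨x, hx, hTx⟩ := T.exists_tiling hE
  rw [← volume_tiles hX hx _ (by rwa [Finite.coe_toFinset]), ← volume_real_smul T.dil_pos,
    ← T.support_eq E hE, sUnion_eq_biUnion]
  simp only [Finite.mem_toFinset]

theorem Inflation.integral_sum (T : Inflation X) (hX : X.HasNullBoundaries) {E : Set (Euc d)}
    (hE : E ∈ X.tileSet) {h : Euc d → ℝ} (hint : IntegrableOn h (T.dil • E)) :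
    T.dil ^ d * ∫ v in E, h (T.dil • v) =
      ∑ F ∈ (T.finite E hE).toFinset, ∫ v in F, h v := by
  obtain ⟨x, hx, hTx⟩ := T.exists_tiling hE
  have hU : ⋃ F ∈ (T.finite E hE).toFinset, F = T.dil • E := by
    rw [← T.support_eq E hE, sUnion_eq_biUnion]
    simp only [Finite.mem_toFinset]
  rw [← integral_tiles hX hx _ (by rwa [Finite.coe_toFinset]) (by rwa [hU]), hU,
    Measure.setIntegral_comp_smul_of_pos _ _ _ T.dil_pos, smul_eq_mul, finrank_euclideanSpace_fin,
    mul_inv_cancel_left₀ (pow_pos T.dil_pos d).ne']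

/-- The integral over a bounded ball is controlled by the integrals over the tiles. -/
theorem abs_integral_ball_sub_le (hP : X.IsPrototiles P) (hX : X.HasNullBoundaries) {C : ℝ}
    (hC : ∀ D ∈ X.tileSet, Metric.diam D ≤ C) {y : Tiling d} (hy : y ∈ X) {h : Euc d → ℝ}
    {B c ε ρ : ℝ} (hε : 0 ≤ ε)
    (hint : ∀ s : Set (Euc d), Bornology.IsBounded s → IntegrableOn h s)
    (hB : ∀ v, |h v| ≤ B) (htile : ∀ E ∈ y.tiles,
      c * volume.real E ≤ ∫ v in E, h v ∧ (∫ v in E, h v) ≤ (c + ε) * volume.real E) :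
    |(∫ v in Metric.ball 0 ρ, h v) - c * volume.real (Metric.ball (0 : Euc d) ρ)| ≤
      ε * volume.real (Metric.ball (0 : Euc d) (ρ + C + 1)) +
      (B + |c|) * (volume.real (Metric.ball (0 : Euc d) (ρ + C + 1)) -
        volume.real (Metric.ball (0 : Euc d) ρ)) := by
  set F := (hP.finite_inter_ball hy 0 ρ).toFinset with hF
  have hFy : (F : Set (Set (Euc d))) ⊆ y.tiles := by
    rw [hF, Finite.coe_toFinset]
    exact fun E hE => hE.1
  set U := ⋃ E ∈ F, E with hU
  have hsub : Metric.ball 0 ρ ⊆ U := fun v hv => by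
    obtain ⟨E, hE, hvE⟩ := y.exists_mem v
    exact mem_iUnion₂.2 ⟨E, (Finite.mem_toFinset _).2 ⟨hE, v, hvE, hv⟩, hvE⟩
  have hsub' : U ⊆ Metric.ball 0 (ρ + C + 1) := by
    refine iUnion₂_subset fun E hE w hw => ?_
    obtain ⟨hEy, v, hvE, hv⟩ := (Finite.mem_toFinset _).1 hE
    have h1 := Metric.dist_le_diam_of_mem (y.isTile hEy).1.isBounded hw hvE
    have h2 := hC E ⟨y, hy, hEy⟩
    rw [Metric.mem_ball] at hv ⊢
    linarith [dist_triangle w v 0]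
  have hUb : Bornology.IsBounded U := Metric.isBounded_ball.subset hsub'
  have hUfin : volume U ≠ ⊤ := hUb.measure_lt_top.ne
  have h1 := integral_tiles hX hy F hFy (hint U hUb)
  have h2 := volume_tiles hX hy F hFy
  rw [← hU] at h1 h2
  have hlow : c * volume.real U ≤ ∫ v in U, h v := by
    rw [h1, h2, Finset.mul_sum]
    exact Finset.sum_le_sum fun E hE => (htile E (hFy hE)).1
  have hupp : (∫ v in U, h v) ≤ (c + ε) * volume.real U := by
    rw [h1, h2, Finset.mul_sum]
    exact Finset.sum_le_sum fun E hE => (htile E (hFy hE)).2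
  -- The union `U` of the tiles meeting the ball obeys the tilewise bounds exactly; the excess of
  -- `U` over the ball lies in the layer of width `C + 1`.
  have h3 : ∫ v in U \ Metric.ball 0 ρ, h v = (∫ v in U, h v) - ∫ v in Metric.ball 0 ρ, h v :=
    setIntegral_sdiff Metric.isOpen_ball.measurableSet (hint U hUb) hsub
  have h4 : volume.real (U \ Metric.ball 0 ρ) =
      volume.real U - volume.real (Metric.ball (0 : Euc d) ρ) :=
    measureReal_sdiff hsub Metric.isOpen_ball.measurableSet
  have h5 : ‖∫ v in U \ Metric.ball 0 ρ, h v‖ ≤ B * volume.real (U \ Metric.ball 0 ρ) :=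
    norm_setIntegral_le_of_norm_le_const
      ((measure_mono sdiff_subset).trans_lt hUb.measure_lt_top) fun v _ => hB v
  rw [h3, h4, Real.norm_eq_abs, abs_le] at h5
  have h6 : volume.real U ≤ volume.real (Metric.ball (0 : Euc d) (ρ + C + 1)) :=
    measureReal_mono hsub' measure_ball_lt_top.ne
  have h7 : volume.real (Metric.ball (0 : Euc d) ρ) ≤ volume.real U := measureReal_mono hsub hUfin
  have hB0 : 0 ≤ B := (abs_nonneg _).trans (hB 0)
  have h8 : (B + |c|) * (volume.real U - volume.real (Metric.ball (0 : Euc d) ρ)) ≤ (B + |c|) *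
      (volume.real (Metric.ball (0 : Euc d) (ρ + C + 1)) -
        volume.real (Metric.ball (0 : Euc d) ρ)) :=
    mul_le_mul_of_nonneg_left (by linarith) (by positivity)
  have h9 : ε * volume.real U ≤ ε * volume.real (Metric.ball (0 : Euc d) (ρ + C + 1)) :=
    mul_le_mul_of_nonneg_left h6 hε
  have h10 : |c * (volume.real U - volume.real (Metric.ball (0 : Euc d) ρ))| ≤
      |c| * (volume.real U - volume.real (Metric.ball (0 : Euc d) ρ)) := by
    rw [abs_mul, abs_of_nonneg (sub_nonneg.2 h7)]
  rw [abs_le] at h10 ⊢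
  constructor <;> nlinarith

/-! ### Contraction of supertile averages -/

section Supertiles

variable {J : Type*} {S : J → Substitution X} {a : ℕ → J} {D : Set (Euc d)}

/-- The integral of `φ` over the supertile of level `n` in `x` given by the tile `E`, rescaled to
the size of `E`. -/
noncomputable def supertileIntegral (φ : multiSpace S a D → ℝ) (n : ℕ) (x : multiSpace S a D)
    (E : Set (Euc d)) : ℝ :=
  ∫ v in E, φ (-((iter S a n).dil • v) +ᵥ x)

/-- The averages of `φ` over the supertiles of level `n` of tilings in the multi-substitution
space lie in `[c, c']`. -/
def SupertileBound (φ : multiSpace S a D → ℝ) (n : ℕ) (c c' : ℝ) : Prop :=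
  ∀ (x : multiSpace S a D) (y : X), ((iter S a n).onTiling y).1 = x.1 → ∀ E ∈ y.1.tiles,
    c * volume.real E ≤ supertileIntegral φ n x E ∧
    supertileIntegral φ n x E ≤ c' * volume.real E

/-- The integrals of `φ` over supertiles of level `n` of the same type differ by at most `e` times
the volume of the tile. -/
def SupertileVariation (φ : multiSpace S a D → ℝ) (n : ℕ) (e : ℝ) : Prop :=
  ∀ (x x' : multiSpace S a D) (y y' : X),
    ((iter S a n).onTiling y).1 = x.1 → ((iter S a n).onTiling y').1 = x'.1 →
    ∀ (E : Set (Euc d)) (s : Euc d), E ∈ y.1.tiles → s +ᵥ E ∈ y'.1.tiles →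
    |supertileIntegral φ n x E - supertileIntegral φ n x' (s +ᵥ E)| ≤ e * volume.real E

/-- Off a thin collar of the boundary the two tilings agree on large balls, so uniform continuity of
`φ` applies; the collar has small volume and `φ` is bounded. -/
theorem exists_variation_le [Finite J] [CompactSpace (multiSpace S a D)] (hP : X.IsPrototiles P)
    (hX : X.HasNullBoundaries) {φ : multiSpace S a D → ℝ} (hφ : Continuous φ) {ε : ℝ}
    (hε : 0 < ε) : ∃ N, ∀ n ≥ N, SupertileVariation φ n ε := by
  have hY := hasBoundedTiles_multiSpace hP.hasBoundedTiles S a D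
  have := hY.continuousVAdd
  obtain ⟨B, hB⟩ := isCompact_univ.exists_bound_of_continuousOn hφ.continuousOn
  obtain ⟨η, hη, hηφ⟩ : ∃ η > 0, ∀ z z' : multiSpace S a D,
      (z.1, z'.1) ∈ tilingEntourage d η → |φ z - φ z'| ≤ ε / 2 := by
    let _ := hY.uniformSpace
    have huc := CompactSpace.uniformContinuous_of_continuous hφ
    obtain ⟨η, hη, h⟩ := (hY.hasBasis.uniformContinuous_iff Metric.uniformity_basis_dist).1 huc
      (ε / 2) (by positivity)
    exact ⟨η, hη, fun z z' hz => (h z z' hz).le⟩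
  set B' := max B 0
  have hB'0 : 0 ≤ B' := le_max_right _ _
  have hB' : ∀ z, |φ z| ≤ B' := fun z => (hB z (mem_univ z)).trans (le_max_left _ _)
  -- With this collar fraction the error `2 * B'` on the collar contributes at most `ε / 2`; the `+
  -- 1` avoids division by zero.
  obtain ⟨ρ, hρ, hcol⟩ := exists_volume_collar_le hP hX (ε := ε / (4 * B' + 1)) (by positivity)
  -- From level `N` on, distance `ρ` from the boundary becomes at least `1 / η` after inflation.
  obtain ⟨N, hN⟩ := Filter.eventually_atTop.1
    ((tendsto_dil_iter S a).eventually_ge_atTop (1 / η / ρ))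
  refine ⟨N, fun n hn x x' y y' hx hx' E s hE hE' => ?_⟩
  have hdil := hN n hn
  unfold supertileIntegral
  set T := iter S a n
  have hEt := y.1.isTile hE
  have hEX : E ∈ X.tileSet := ⟨y.1, y.2, hE⟩
  have htrans : ∫ v in s +ᵥ E, φ (-(T.dil • v) +ᵥ x') =
      ∫ v in E, φ (-(T.dil • (s + v)) +ᵥ x') :=
    (measurePreserving_add_left volume s).setIntegral_image_emb
      (measurableEmbedding_addLeft s) (fun v => φ (-(T.dil • v) +ᵥ x')) E
  have hi1 : IntegrableOn (fun v : Euc d => φ (-(T.dil • v) +ᵥ x)) E :=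
    integrableOn_orbit hφ T.dil x hEt.1.isBounded
  have hi2 : IntegrableOn (fun v : Euc d => φ (-(T.dil • (s + v)) +ᵥ x')) E := by
    have h1 := integrableOn_orbit hφ T.dil (-(T.dil • s) +ᵥ x') hEt.1.isBounded
    simpa only [vadd_vadd, smul_add, neg_add_rev] using h1
  rw [htrans, ← integral_sub hi1 hi2]
  have hi : IntegrableOn (fun v : Euc d => φ (-(T.dil • v) +ᵥ x) -
      φ (-(T.dil • (s + v)) +ᵥ x')) E := hi1.sub hi2
  set K := Metric.thickening ρ (interior E)ᶜ
  have hK : MeasurableSet K := Metric.isOpen_thickening.measurableSet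
  rw [← integral_inter_add_sdiff hK hi]
  have h1 : ‖∫ v in E ∩ K, (φ (-(T.dil • v) +ᵥ x) - φ (-(T.dil • (s + v)) +ᵥ x'))‖ ≤
      2 * B' * volume.real (E ∩ K) := by
    refine norm_setIntegral_le_of_norm_le_const
      ((measure_mono inter_subset_left).trans_lt hEt.1.measure_lt_top) fun v _ => ?_
    have h2 := abs_le.1 (hB' (-(T.dil • v) +ᵥ x))
    have h3 := abs_le.1 (hB' (-(T.dil • (s + v)) +ᵥ x'))
    rw [Real.norm_eq_abs, abs_le]
    constructor <;> linarith
  have h2 : ‖∫ v in E \ K, (φ (-(T.dil • v) +ᵥ x) - φ (-(T.dil • (s + v)) +ᵥ x'))‖ ≤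
      ε / 2 * volume.real (E \ K) := by
    refine norm_setIntegral_le_of_norm_le_const
      ((measure_mono sdiff_subset).trans_lt hEt.1.measure_lt_top) fun v hv => ?_
    refine hηφ _ _ ⟨0, by rw [norm_zero]; exact hη.le, ?_⟩
    have hball : Metric.ball v ρ ⊆ interior E := by
      intro u hu
      by_contra hne
      exact hv.2 (Metric.mem_thickening_iff.2 ⟨u, hne, by rwa [dist_comm]⟩)
    have h3 := T.agree_of_ball_subset hE hE' hball (R := 1 / η)
      (by rwa [div_le_iff₀ hρ] at hdil)
    rw [hx, hx'] at h3
    exact h3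
  have h3 := hcol E hEX
  have h4 : volume.real (E \ K) ≤ volume.real E :=
    measureReal_mono sdiff_subset hEt.volume_ne_top
  have h5 : 2 * B' * volume.real (E ∩ K) ≤ ε / 2 * volume.real E := by
    have h6 : 2 * B' * (ε / (4 * B' + 1)) ≤ ε / 2 := by
      rw [← mul_div_assoc, div_le_iff₀ (by positivity)]
      nlinarith
    calc 2 * B' * volume.real (E ∩ K) ≤ 2 * B' * (ε / (4 * B' + 1) * volume.real E) :=
          mul_le_mul_of_nonneg_left h3 (by positivity)
      _ = 2 * B' * (ε / (4 * B' + 1)) * volume.real E := by ring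
      _ ≤ _ := mul_le_mul_of_nonneg_right h6 measureReal_nonneg
  have h7 : ε / 2 * volume.real (E \ K) ≤ ε / 2 * volume.real E :=
    mul_le_mul_of_nonneg_left h4 (by positivity)
  rw [Real.norm_eq_abs] at h1 h2
  refine (abs_add_le _ _).trans ?_
  linarith

/-- Finitely many tile types and finitely many dilatation factors bound inflated volumes above and
tile volumes below, uniformly in the sequence. -/
theorem exists_volume_ratio [Finite J] (hP : X.IsPrototiles P) (S : J → Substitution X) (K : ℕ) :
    ∃ δ > 0, δ < 1 ∧ ∀ b : ℕ → J, ∀ E ∈ X.tileSet, ∀ E' ∈ X.tileSet,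
      δ * ((iter S b K).dil ^ d * volume.real E) ≤ volume.real E' := by
  obtain ⟨c, hc, hcS⟩ := dil_iter_le_pow S
  obtain ⟨v, hv, hvP⟩ := hP.exists_le_volume
  have htop : ∀ E ∈ X.tileSet, volume.real E ≤ ∑ i, volume.real (P i) := by
    intro E hE
    obtain ⟨i, t, rfl⟩ := hP.exists_equiv E hE
    rw [volume_real_vadd]
    exact Finset.single_le_sum (f := fun i => volume.real (P i)) (fun _ _ => measureReal_nonneg)
      (Finset.mem_univ i)
  set W := (c ^ K) ^ d * ∑ i, volume.real (P i) with hW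
  have hW0 : 0 ≤ W :=
    mul_nonneg (by positivity) (Finset.sum_nonneg fun _ _ => measureReal_nonneg)
  set m := (min v 1).toReal with hm
  have hm1 : min v 1 ≠ ⊤ := ((min_le_right _ _).trans_lt ENNReal.one_lt_top).ne
  have hm0 : 0 < m := ENNReal.toReal_pos (lt_min hv one_pos).ne' hm1
  refine ⟨min (m / (W + 1)) (1 / 2), by positivity,
    (min_le_right _ _).trans_lt (by norm_num), fun b E hE E' hE' => ?_⟩
  have hE't := TilingSpace.isTile_of_mem hE'
  have h1 : m ≤ volume.real E' := by
    refine ENNReal.toReal_mono hE't.volume_ne_top ?_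
    exact (min_le_left _ _).trans ((hvP E' hE').trans (measure_mono interior_subset))
  have h2 : (iter S b K).dil ^ d * volume.real E ≤ W :=
    mul_le_mul (pow_le_pow_left₀ (iter S b K).dil_pos.le (hcS b K) d) (htop E hE)
      measureReal_nonneg (by positivity)
  calc min (m / (W + 1)) (1 / 2) * ((iter S b K).dil ^ d * volume.real E)
      ≤ m / (W + 1) * W := mul_le_mul (min_le_left _ _) h2
        (mul_nonneg (pow_nonneg (iter S b K).dil_pos.le d) measureReal_nonneg) (by positivity)
    _ ≤ m := by
        rw [div_mul_eq_mul_div, div_le_iff₀ (by positivity)]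
        nlinarith
    _ ≤ _ := h1

/-- Fix one type, that of `E₀`. Its level-`n` averages lie within `e` of a single number `g`, and by
fullness each supertile `K` levels up contains such a piece with volume fraction at least `δ`. The
rest of it still averages into `[c, c + w]`. -/
theorem SupertileBound.contract [CompactSpace (multiSpace S a D)] [CompactSpace X]
    [Nonempty (multiSpace S a D)] (hS : PrimitiveSet S P) (hP : X.IsPrototiles P)
    (hD : D ∈ X.tileSet) (hX : X.HasNullBoundaries) {φ : multiSpace S a D → ℝ}
    (hφ : Continuous φ) {n K : ℕ} (hK : Full S P (shift^[n] a) K) {δ e c w : ℝ} (hδ0 : 0 < δ)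
    (hδ : ∀ E ∈ X.tileSet, ∀ E' ∈ X.tileSet,
      δ * ((iter S (shift^[n] a) K).dil ^ d * volume.real E) ≤ volume.real E')
    (he : SupertileVariation φ n e)
    (h : SupertileBound φ n c (c + w)) :
    ∃ c', SupertileBound φ (n + K) c' (c' + ((1 - δ) * w + δ * (2 * e))) := by
  have hY := hasBoundedTiles_multiSpace hP.hasBoundedTiles S a D
  have := hY.continuousVAdd
  obtain ⟨x₀⟩ := ‹Nonempty (multiSpace S a D)›
  obtain ⟨y₀, -, hy₀⟩ := exists_onTiling_iter_eq hS hP hD n x₀.2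
  obtain ⟨E₀, hE₀, -⟩ := y₀.1.exists_mem 0
  have hE₀X : E₀ ∈ X.tileSet := ⟨y₀.1, y₀.2, hE₀⟩
  have hE₀pos : 0 < volume.real E₀ :=
    (TilingSpace.isTile_of_mem hE₀X).volume_interior_pos.trans_le
      (measureReal_mono interior_subset (TilingSpace.isTile_of_mem hE₀X).volume_ne_top)
  obtain ⟨i, t₀, ht₀⟩ := hP.exists_equiv E₀ hE₀X
  set g := supertileIntegral φ n x₀ E₀ / volume.real E₀ with hg
  have hgE : supertileIntegral φ n x₀ E₀ = g * volume.real E₀ := by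
    rw [hg, div_mul_cancel₀ _ hE₀pos.ne']
  -- the averages over the supertiles of the type of `E₀` are close to `g`
  have hclose : ∀ (x : multiSpace S a D) (y : X), ((iter S a n).onTiling y).1 = x.1 →
      ∀ t : Euc d, t +ᵥ P i ∈ y.1.tiles →
      (g - e) * volume.real (t +ᵥ P i) ≤
        supertileIntegral φ n x (t +ᵥ P i) ∧
      supertileIntegral φ n x (t +ᵥ P i) ≤
        (g + e) * volume.real (t +ᵥ P i) := by
    intro x y hxy t ht
    have h1 : t +ᵥ P i = (t - t₀) +ᵥ E₀ := by rw [ht₀, vadd_vadd, sub_add_cancel]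
    rw [h1] at ht ⊢
    have h2 := abs_le.1 (he x₀ x y₀ y hy₀ hxy E₀ (t - t₀) hE₀ ht)
    rw [hgE] at h2
    rw [volume_real_vadd]
    constructor <;> linarith
  -- `[m, u]` combines both constraints on the averages of the chosen type. Since `c ≤ m` and `u ≤ c
  -- + w`, the actual volume fraction of the piece may be replaced by its lower bound `δ`.
  set u := min (g + e) (c + w) with hu
  set m := max (g - e) c with hm
  have hum : u - m ≤ 2 * e := by
    have h1 := min_le_left (g + e) (c + w)
    have h2 := le_max_left (g - e) c
    linarith
  have hucw : u ≤ c + w := min_le_right _ _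
  have hmc : c ≤ m := le_max_right _ _
  refine ⟨(1 - δ) * c + δ * m, fun x y hxy E hE => ?_⟩
  set T := iter S a n with hT
  set U := iter S (shift^[n] a) K with hU
  rw [iter_add, ← hT, ← hU] at hxy
  rw [Inflation.onTiling_comp] at hxy
  have hEX : E ∈ X.tileSet := ⟨y.1, y.2, hE⟩
  have hUy : U.toFun E ⊆ (U.onTiling y).1.tiles := fun F hF =>
    Inflation.mem_onTiling.2 ⟨E, hE, hF⟩
  obtain ⟨t, ht⟩ : ∃ t : Euc d, t +ᵥ P i ∈ U.toFun E := by
    obtain ⟨j, s, rfl⟩ := hP.exists_equiv E hEX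
    obtain ⟨t, ht⟩ := hK i j
    exact ⟨U.dil • s + t, by rw [add_vadd]; exact U.vadd_mem (hP.mem j) ht⟩
  have hint : IntegrableOn (fun v : Euc d => φ (-(T.dil • v) +ᵥ x)) (U.dil • E) :=
    integrableOn_orbit hφ T.dil x ((y.1.isTile hE).1.isBounded.smul₀ U.dil)
  have hsum := U.integral_sum hX hEX hint
  have hvol := U.volume_sum hX hEX
  set F := (U.finite E hEX).toFinset with hF
  have hmem : ∀ {G}, G ∈ F ↔ G ∈ U.toFun E := (U.finite E hEX).mem_toFinset
  have hE₁ : t +ᵥ P i ∈ F := hmem.2 ht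
  set v₁ := volume.real (t +ᵥ P i) with hv₁
  set W := U.dil ^ d * volume.real E with hW
  have hdil : 0 < U.dil ^ d := pow_pos U.dil_pos d
  have hδW : δ * W ≤ v₁ := hδ E hEX _ (U.mem_tileSet hEX ht)
  have hv₁0 : 0 ≤ v₁ := measureReal_nonneg
  have hb := h x (U.onTiling y) hxy
  have hb₁ := hb _ (hUy ht)
  have hc₁ := hclose x (U.onTiling y) hxy t (hUy ht)
  have hlow₁ : m * v₁ ≤ supertileIntegral φ n x (t +ᵥ P i) := by
    rcases max_choice (g - e) c with h' | h' <;> rw [hm, h']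
    exacts [hc₁.1, hb₁.1]
  have hupp₁ : supertileIntegral φ n x (t +ᵥ P i) ≤ u * v₁ := by
    rcases min_choice (g + e) (c + w) with h' | h' <;> rw [hu, h']
    exacts [hc₁.2, hb₁.2]
  have hvol' : ∑ G ∈ F.erase (t +ᵥ P i), volume.real G = W - v₁ := by
    rw [← hvol, ← Finset.sum_erase_add _ _ hE₁, add_sub_cancel_right]
  have hlow : c * (W - v₁) ≤ ∑ G ∈ F.erase (t +ᵥ P i), supertileIntegral φ n x G := by
    rw [← hvol', Finset.mul_sum]
    exact Finset.sum_le_sum fun G hG => (hb G (hUy (hmem.1 (Finset.mem_of_mem_erase hG)))).1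
  have hupp : ∑ G ∈ F.erase (t +ᵥ P i), supertileIntegral φ n x G ≤ (c + w) * (W - v₁) := by
    rw [← hvol', Finset.mul_sum]
    exact Finset.sum_le_sum fun G hG => (hb G (hUy (hmem.1 (Finset.mem_of_mem_erase hG)))).2
  have hint' : U.dil ^ d * supertileIntegral φ (n + K) x E =
      ∑ G ∈ F, supertileIntegral φ n x G := by
    refine Eq.trans ?_ hsum
    unfold supertileIntegral
    rw [iter_add, ← hT, ← hU, show (T.comp U).dil = T.dil * U.dil from rfl]
    simp only [mul_smul]
  rw [← Finset.sum_erase_add _ _ hE₁] at hint'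
  have h1 : (m - c) * (δ * W) ≤ (m - c) * v₁ := mul_le_mul_of_nonneg_left hδW (by linarith)
  have h2 : (c + w - u) * (δ * W) ≤ (c + w - u) * v₁ :=
    mul_le_mul_of_nonneg_left hδW (by linarith)
  have hW0 : 0 ≤ W := mul_nonneg hdil.le measureReal_nonneg
  have h3 : (u - m) * (δ * W) ≤ 2 * e * (δ * W) :=
    mul_le_mul_of_nonneg_right hum (mul_nonneg hδ0.le hW0)
  constructor
  · refine le_of_mul_le_mul_left ?_ hdil
    rw [hint', mul_left_comm, ← hW]
    nlinarith
  · refine le_of_mul_le_mul_left ?_ hdil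
    rw [hint', mul_left_comm, ← hW]
    nlinarith

theorem exists_supertileBound [Finite J] [CompactSpace (multiSpace S a D)] [CompactSpace X]
    [Nonempty (multiSpace S a D)] (hS : PrimitiveSet S P) (hP : X.IsPrototiles P)
    (hD : D ∈ X.tileSet) (hX : X.HasNullBoundaries) {φ : multiSpace S a D → ℝ}
    (hφ : Continuous φ) {ε : ℝ} (hε : 0 < ε) : ∃ n c, SupertileBound φ n c (c + ε) := by
  obtain ⟨K, hK⟩ := hS.exists_forall_full hP
  obtain ⟨δ, hδ0, hδ1, hδ⟩ := exists_volume_ratio hP S K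
  obtain ⟨N, hN⟩ := exists_variation_le hP hX hφ (ε := ε / 4) (by positivity)
  obtain ⟨B, hB⟩ := isCompact_univ.exists_bound_of_continuousOn hφ.continuousOn
  have hstart : SupertileBound φ N (-B) (-B + 2 * B) := by
    intro x y hxy E hE
    have h1 : ‖supertileIntegral φ N x E‖ ≤ B * volume.real E :=
      norm_setIntegral_le_of_norm_le_const (y.1.isTile hE).1.measure_lt_top
        fun v _ => hB _ (mem_univ _)
    rw [Real.norm_eq_abs, abs_le] at h1
    constructor <;> linarith
  -- With variation `ε / 4` the width recursion has fixed point `ε / 2`, and the excess over it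
  -- shrinks by `1 - δ` at each round.
  have hiter : ∀ m : ℕ, ∃ c,
      SupertileBound φ (N + m * K) c (c + (ε / 2 + (1 - δ) ^ m * (2 * B))) := by
    intro m
    induction m with
    | zero =>
      refine ⟨-B, fun x y hxy E hE => ?_⟩
      rw [zero_mul, add_zero] at hxy ⊢
      have h1 := hstart x y hxy E hE
      refine ⟨h1.1, h1.2.trans (mul_le_mul_of_nonneg_right ?_ measureReal_nonneg)⟩
      rw [pow_zero]
      linarith
    | succ m ih =>
      obtain ⟨c, hc⟩ := ih
      obtain ⟨c', hc'⟩ := hc.contract hS hP hD hX hφ (hK _) hδ0 (hδ _)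
        (hN _ (Nat.le_add_right _ _))
      refine ⟨c', ?_⟩
      have h1 : (1 - δ) * (ε / 2 + (1 - δ) ^ m * (2 * B)) + δ * (2 * (ε / 4)) =
          ε / 2 + (1 - δ) ^ (m + 1) * (2 * B) := by ring
      rw [h1] at hc'
      rwa [Nat.succ_mul, ← add_assoc]
  obtain ⟨m, hm⟩ := exists_pow_lt_of_lt_one (x := ε / 2 / (2 * |B| + 1)) (y := 1 - δ)
    (by positivity) (by linarith)
  obtain ⟨c, hc⟩ := hiter m
  refine ⟨_, c, fun x y hxy E hE => ⟨(hc x y hxy E hE).1, (hc x y hxy E hE).2.trans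
    (mul_le_mul_of_nonneg_right ?_ measureReal_nonneg)⟩⟩
  rw [lt_div_iff₀ (by positivity)] at hm
  have h1 : 0 ≤ (1 - δ) ^ m := pow_nonneg (by linarith) m
  nlinarith [le_abs_self B]

theorem tendsto_ball_ratio (C : ℝ) :
    Filter.Tendsto (fun ρ : ℝ => ((ρ + C) / ρ) ^ d) Filter.atTop (nhds 1) := by
  have h1 : Filter.Tendsto (fun ρ : ℝ => 1 + C / ρ) Filter.atTop (nhds (1 + 0)) :=
    tendsto_const_nhds.add (Filter.tendsto_id.const_div_atTop C)
  rw [add_zero] at h1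
  have h2 := h1.pow d
  rw [one_pow] at h2
  refine h2.congr' ?_
  filter_upwards [Filter.eventually_gt_atTop 0] with ρ hρ
  rw [add_div, div_self hρ.ne']

/-- Write `x` as `T` of a tiling `y` and rescale: a ball of radius `T.dil * ρ` becomes one of radius
`ρ` tiled by `y`, whose tiles carry averages in `[c, c + ε / 2]`. The boundary layer has bounded
width, so its volume share tends to zero uniformly in `x`. -/
theorem exists_ballAvg_bound [Finite J] [CompactSpace (multiSpace S a D)] [CompactSpace X]
    [Nonempty (multiSpace S a D)] (hS : PrimitiveSet S P) (hP : X.IsPrototiles P)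
    (hD : D ∈ X.tileSet) (hX : X.HasNullBoundaries) {φ : multiSpace S a D → ℝ}
    (hφ : Continuous φ) {ε : ℝ} (hε : 0 < ε) :
    ∃ c R₀ : ℝ, ∀ R ≥ R₀, ∀ x, |ballAvg (d := d) φ R x - c| ≤ ε := by
  have hY := hasBoundedTiles_multiSpace hP.hasBoundedTiles S a D
  have := hY.continuousVAdd
  obtain ⟨n, c, hc⟩ := exists_supertileBound hS hP hD hX hφ (half_pos hε)
  obtain ⟨B, hB⟩ := isCompact_univ.exists_bound_of_continuousOn hφ.continuousOn
  obtain ⟨C, hC0, hC⟩ := hP.exists_diam_le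
  set T := iter S a n with hT
  have hlim : Filter.Tendsto (fun ρ : ℝ => ε / 2 * ((ρ + (C + 1)) / ρ) ^ d +
      (B + |c|) * (((ρ + (C + 1)) / ρ) ^ d - 1)) Filter.atTop (nhds (ε / 2)) := by
    have h1 := tendsto_ball_ratio (d := d) (C + 1)
    have h2 := (h1.const_mul (ε / 2)).add ((h1.sub_const 1).const_mul (B + |c|))
    simpa using h2
  obtain ⟨ρ₀, hρ₀⟩ := Filter.eventually_atTop.1
    ((hlim.eventually_lt_const (half_lt_self hε)).and (Filter.eventually_gt_atTop 0))
  refine ⟨c, T.dil * ρ₀, fun R hR x => ?_⟩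
  obtain ⟨ρ, rfl⟩ : ∃ ρ, R = T.dil * ρ := ⟨R / T.dil, by field_simp [T.dil_pos.ne']⟩
  have hρ : ρ₀ ≤ ρ := le_of_mul_le_mul_left hR T.dil_pos
  obtain ⟨hlt, hρ0⟩ := hρ₀ ρ hρ
  obtain ⟨y, -, hy⟩ := exists_onTiling_iter_eq hS hP hD n x.2
  have hest := abs_integral_ball_sub_le hP hX hC y.2 (half_pos hε).le (ρ := ρ)
    (h := fun v => φ (-(T.dil • v) +ᵥ x)) (fun s hs => integrableOn_orbit hφ T.dil x hs)
    (fun v => hB _ (mem_univ _)) (hc x y hy)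
  set ω := volume.real (Metric.ball (0 : Euc d) 1) with hω
  have hω0 : 0 < ω := ENNReal.toReal_pos (Metric.measure_ball_pos volume _ one_pos).ne'
    measure_ball_lt_top.ne
  have hball : ∀ r > 0, volume.real (Metric.ball (0 : Euc d) r) = r ^ d * ω := fun r hr => by
    rw [hω, ← volume_real_smul hr, smul_unitBall_of_pos hr]
  rw [hball ρ hρ0, hball (ρ + C + 1) (by linarith)] at hest
  have havg : ballAvg (d := d) φ (T.dil * ρ) x =
      (ρ ^ d * ω)⁻¹ * ∫ v in Metric.ball (0 : Euc d) ρ, φ (-(T.dil • v) +ᵥ x) := by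
    have h1 : Metric.ball (0 : Euc d) (T.dil * ρ) = T.dil • Metric.ball 0 ρ := by
      rw [smul_ball T.dil_pos.ne', smul_zero, Real.norm_of_nonneg T.dil_pos.le]
    rw [ballAvg, setAverage_eq, hball _ (mul_pos T.dil_pos hρ0), h1,
      Measure.setIntegral_comp_smul_of_pos volume
        (fun v : Euc d => φ (-v +ᵥ x)) _ T.dil_pos,
      finrank_euclideanSpace_fin, smul_eq_mul, smul_eq_mul, mul_pow]
    have := (pow_pos T.dil_pos d).ne'
    field_simp
  have hρd : 0 < ρ ^ d := pow_pos hρ0 d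
  have h2 : ballAvg (d := d) φ (T.dil * ρ) x - c = (ρ ^ d * ω)⁻¹ *
      ((∫ v in Metric.ball (0 : Euc d) ρ, φ (-(T.dil • v) +ᵥ x)) - c * (ρ ^ d * ω)) := by
    rw [havg]
    field_simp
  rw [h2, abs_mul, abs_of_pos (by positivity), inv_mul_le_iff₀ (by positivity)]
  refine hest.trans ?_
  have h3 : ε / 2 * ((ρ + C + 1) ^ d * ω) +
      (B + |c|) * ((ρ + C + 1) ^ d * ω - ρ ^ d * ω) = (ρ ^ d * ω) *
      (ε / 2 * ((ρ + (C + 1)) / ρ) ^ d + (B + |c|) * (((ρ + (C + 1)) / ρ) ^ d - 1)) := by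
    rw [div_pow, ← add_assoc]
    field_simp
  rw [h3]
  exact mul_le_mul_of_nonneg_left hlt.le (by positivity)

end Supertiles

end MultiTiling

namespace MultiTiling

variable {d : ℕ} {X : TilingSpace d} {J : Type*} {l : ℕ} {P : Fin l → Set (Euc d)}

/-! ### Unique ergodicity and renormalization -/

theorem exists_isUniqueErgodicMeasure [Finite J] {S : J → Substitution X}
    (hS : PrimitiveSet S P) (hP : X.IsPrototiles P) (a : ℕ → J) {D : Set (Euc d)}
    (hD : D ∈ X.tileSet) [CompactSpace X] :
    ∃ μ : Measure (multiSpace S a D), (multiSpace S a D).IsUniqueErgodicMeasure μ := by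
  have hY := hasBoundedTiles_multiSpace hP.hasBoundedTiles S a D
  have := compactSpace_multiSpace hS hP a hD
  have := nonempty_multiSpace hS hP a hD
  have := hY.t2Space
  have := hY.continuousVAdd
  have : TopologicalSpace.PseudoMetrizableSpace (multiSpace S a D) := by
    let _ := hY.uniformSpace
    have := hY.isCountablyGenerated
    infer_instance
  have hX : X.HasNullBoundaries := fun _ hE => (S (a 0)).volume_boundary hP hE
  obtain ⟨μ, h1, h2, h3⟩ := exists_unique_ergodic (d := d) (Y := multiSpace S a D)
    fun φ ε hε => exists_ballAvg_bound hS hP hD hX φ.continuous hε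
  exact ⟨μ, h1, h2, h3⟩

/-- Multiplication by `c ≠ 0` as an automorphism of the additive group `ℝ^d`. -/
noncomputable def dilation (d : ℕ) {c : ℝ} (hc : c ≠ 0) : Euc d ≃+ Euc d :=
  DistribMulAction.toAddEquiv₀ (Euc d) c hc

/-- A homeomorphism that intertwines two uniquely ergodic actions through an automorphism of
`ℝ^d` carries one invariant measure to the other. -/
theorem TilingSpace.IsUniqueErgodicMeasure.isSystemIso {Y Z : TilingSpace d} {ν : Measure Y}
    {μ : Measure Z} (hν : Y.IsUniqueErgodicMeasure ν) (hμ : Z.IsUniqueErgodicMeasure μ)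
    {ξ : Euc d ≃+ Euc d} {F : Y ≃ₜ Z} (hF : ∀ (t : Euc d) (x : Y), F (t +ᵥ x) = ξ t +ᵥ F x)
    (hZ : ContinuousVAdd (Euc d) Z) : IsSystemIso ν μ ξ F := by
  have hm : Measurable F := F.continuous.measurable
  have := hν.isProbabilityMeasure
  have := hν.ergodic
  refine ⟨⟨hm, hμ.unique _ (Measure.isProbabilityMeasure_map hm.aemeasurable) ⟨?_⟩⟩, hF⟩
  intro t B hB
  have ht : Measurable fun z : Z => t +ᵥ z := (continuous_const_vadd t).measurable
  -- Pulled back by `F`, translation by `t` is translation by `ξ.symm t`, under which `ν` is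
  -- invariant.
  rw [Measure.map_apply hm (ht hB), Measure.map_apply hm hB,
    ← measure_preimage_vadd ν (ξ.symm t) (F ⁻¹' B)]
  congr 1
  ext x
  simp only [mem_preimage, hF, AddEquiv.apply_symm_apply]

end MultiTiling

theorem mainTheorem6 {d : ℕ} (X : MultiTiling.TilingSpace d)
    (hcomplete : X.IsComplete) (hflc : X.HasFLC)
    {l : ℕ} (P : Fin l → Set (MultiTiling.Euc d)) (hP : X.IsPrototiles P)
    {J : Type*} [Finite J] (S : J → MultiTiling.Substitution X)
    (hprim : MultiTiling.PrimitiveSet S P)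
    (hrec : ∀ j, (S j).StronglyRecognizable)
    (a : ℕ → J) (D : Set (MultiTiling.Euc d)) (hD : D ∈ X.tileSet) :
    ∃ (μ : MeasureTheory.Measure (MultiTiling.multiSpace S a D))
      (ν : MeasureTheory.Measure (MultiTiling.multiSpace S (MultiTiling.shift a) D)),
      (MultiTiling.multiSpace S a D).IsUniqueErgodicMeasure μ ∧
      (MultiTiling.multiSpace S (MultiTiling.shift a) D).IsUniqueErgodicMeasure ν ∧
      ∃ (ξ : MultiTiling.Euc d ≃+ MultiTiling.Euc d)
        (F : MultiTiling.multiSpace S (MultiTiling.shift a) D ≃ₜ MultiTiling.multiSpace S a D),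
        (∀ t, ξ t = (S (a 0)).dil • t) ∧
        (∀ x, (F x).1.tiles = (S (a 0)).onPatch x.1.tiles) ∧
        MultiTiling.TilingSpace.IsSystemIso ν μ ξ F := by
  have := hP.compactSpace hflc hcomplete
  have hY := MultiTiling.hasBoundedTiles_multiSpace hP.hasBoundedTiles S a D
  have := MultiTiling.compactSpace_multiSpace hprim hP (MultiTiling.shift a) hD
  have := hY.t2Space
  obtain ⟨μ, hμ⟩ := MultiTiling.exists_isUniqueErgodicMeasure hprim hP a hD
  obtain ⟨ν, hν⟩ := MultiTiling.exists_isUniqueErgodicMeasure hprim hP (MultiTiling.shift a) hD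
  -- Continuity of the inverse comes for free: the source is compact and the target Hausdorff.
  refine ⟨μ, ν, hμ, hν,
    MultiTiling.dilation d (S (a 0)).toInflation.dil_pos.ne',
    (MultiTiling.continuous_substMap hprim hP a hD).homeoOfEquivCompactToT2
      (f := Equiv.ofBijective _ (MultiTiling.bijective_substMap hprim hP a hD (hrec (a 0)).1)),
    fun t => rfl, fun x => rfl, ?_⟩
  exact hν.isSystemIso hμ (fun t x => MultiTiling.substMap_vadd hprim hP a hD t x)
    hY.continuousVAdd
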